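/- Let $\Delta$ be a prime, reduced, alternating, oriented planar knot diagram with $n\ge 1$ crossings and a base point. Its augmented Dehn presentation $\mathcal A_\Delta$ has one generator $X_r$ for each of the $n+2$ regions $r$ of $\Delta$ (the unbounded one included), and for each crossing one relator $X_aX_b^{-1}X_cX_d^{-1}$, where $a,b,c,d$ are the regions in cyclic order around the crossing and the overcrossing strand separates $a$ from $b$ and $c$ from $d$. A word is geodesic if no word representing the same element of $\mathcal A_\Delta$ is shorter. Let $\lambda\in\mathcal A_\Delta$ be the element of the blackboard-framed parallel of $\Delta$: walking once around $\Delta$ from the base point, each passage under a strand, from a region $a$ to a region $b$ (read on one side of the knot), contributes $X_aX_b^{-1}$. Let $\mu=X_rX_l^{-1}$, where $r$ and $l$ are the regions on the right and on the left of the edge containing the base point (the meridian oriented by the right-hand rule). An element is peripheral if it equals $\lambda^a\mu^b$ for some $a,b\in\mathbb Z$. Number the crossings $c_1,\dots,c_{2n}$ in the order in which they are met when walking from the base point, $c_1$ being the first undercrossing, indices mod $2n$. Let $l_k,r_k$ be the regions on the left and on the right of the edge leading to $c_k$. The peripheral complex is the tiling of $\mathbb R^2$ by unit squares with integral vertices in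 which the square with lower left corner $(x,y)$ is the relator square $C_{1+x+y}$ of the crossing $c_{1+x+y}$. Here the bottom, right, top, left edges of $C_k$ are labelled $l_k,l_{k+1},r_{k+1},r_k$ for $k$ odd and $r_k,r_{k+1},l_{k+1},l_k$ for $k$ even; equivalently, $C_1$ is placed with bottom, right, top, left edges $l_1,l_2,r_2,r_1$, and each $C_{k+1}$ is glued along its left edge to the equally labelled right edge of $C_k$. Edges are oriented so that vertices with even coordinate sum are sources and the others are sinks; an edge labelled $r$ contributes $X_r$ when it is traversed along its orientation and $X_r^{-1}$ otherwise. Then for every geodesic word $w$ in $\mathcal A_\Delta$ and all $a,b\in\mathbb Z$: $w$ represents $\lambda^a\mu^b$ if and only if $w$ labels a geodesic edge-path in the peripheral complex from $(0,0)$ to $(an-b,\,an+b)$. If $C_1$ is placed in the other admissible way (with bottom, right, top, left edges $r_1,r_2,l_2,l_1$, so that left and right are exchanged in all squares), the same holds with endpoint $(an+b,\,an-b)$. Moreover the peripheral word problem is solvable in polynomial time: for each such $\Delta$ there is a (multi-stack) Turing machine that, given a word in the generators of $\mathcal A_\Delta$ and their inverses, decides whether it represents a peripheral element, in a number of steps bounded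 by a polynomial in the length of the word. -/

import Mathlib

/-- The two sides of an oriented strand. -/
inductive Side : Type
  | left
  | right

/-- The opposite side. -/
def Side.flip : Side → Side
  | .left => .right
  | .right => .left

/-- Two of the corners of two strands that cross: passage `i` runs from edge `i` to edge `i + 1`,
passage `j` runs from edge `j` to edge `j + 1`, and strand `j` crosses strand `i` from the right of
`i` to the left of `i`. The relation says that two sides of edges meet in a corner of the crossing.
With strand `i` going north and strand `j` going west, the four corners are NE, NW, SW, SE. -/
inductive CornerRel {m : ℕ} (partner : ZMod m → ZMod m) (fromRight : ZMod m → Bool) :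
    ZMod m × Side → ZMod m × Side → Prop
  | northEast (i : ZMod m) (h : fromRight i = true) :
      CornerRel partner fromRight (i + 1, .right) (partner i, .right)
  | northWest (i : ZMod m) (h : fromRight i = true) :
      CornerRel partner fromRight (i + 1, .left) (partner i + 1, .right)
  | southWest (i : ZMod m) (h : fromRight i = true) :
      CornerRel partner fromRight (i, .left) (partner i + 1, .left)
  | southEast (i : ZMod m) (h : fromRight i = true) :
      CornerRel partner fromRight (i, .right) (partner i, .left)

/-- An oriented, based, planar knot diagram with `n ≥ 1` crossings, given by its signed Gauss code.
Walking once around the knot from the base point one passes `2 n` times through a crossing; these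
passages are numbered by `ZMod (2 * n)`, starting with passage `0`. Edge `k` is the edge that leads
to passage `k` (and comes from passage `k - 1`); the base point lies on edge `0`. -/
structure KnotDiagram (n : ℕ) where
  crossings_pos : 0 < n
  /-- the other passage through the same crossing -/
  partner : ZMod (2 * n) → ZMod (2 * n)
  partner_partner : ∀ i, partner (partner i) = i
  partner_ne : ∀ i, partner i ≠ i
  /-- whether passage `i` is the overcrossing passage -/
  isOver : ZMod (2 * n) → Bool
  isOver_partner : ∀ i, isOver (partner i) = !isOver i
  /-- whether the other strand, seen along passage `i`, crosses from right to left -/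
  fromRight : ZMod (2 * n) → Bool
  fromRight_partner : ∀ i, fromRight (partner i) = !fromRight i
  /-- Planarity. The complementary regions of the diagram on its closed oriented ribbon surface are
  the classes of sides of edges under the corner relation. The underlying graph is connected with
  `n` vertices and `2 n` edges, so the surface is the sphere iff there are `n + 2` regions. -/
  planar : Nat.card (Quot (CornerRel partner fromRight)) = n + 2

namespace KnotDiagram

variable {n : ℕ} (D : KnotDiagram n)

/-- The regions of the diagram. -/
def Region : Type := Quot (CornerRel D.partner D.fromRight)

/-- The region on side `s` of edge `k`. -/
def regionAt (k : ZMod (2 * n)) (s : Side) : D.Region :=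
  Quot.mk (CornerRel D.partner D.fromRight) (k, s)

/-- The passages are alternately over and under. -/
def Alternating : Prop := ∀ i, D.isOver (i + 1) = !D.isOver i

/-- The four corners at a crossing belong to four different regions, that is, there are no nugatory
crossings. -/
def Reduced : Prop :=
  ∀ i, [D.regionAt i .left, D.regionAt (i + 1) .left,
    D.regionAt (i + 1) .right, D.regionAt i .right].Nodup

/-- No closed curve meets the diagram exactly in one transverse point on each of two different
edges: such a curve exists iff the two edges have the same two regions on their sides. -/
def Prime : Prop :=
  ∀ e f : ZMod (2 * n), e ≠ f →
    s(D.regionAt e .left, D.regionAt e .right) ≠ s(D.regionAt f .left, D.regionAt f .right)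

/-! ### The augmented Dehn presentation -/

/-- The relator of the crossing at which passage `i` is the undercrossing. It is
`X_a X_b⁻¹ X_c X_d⁻¹`, where `a, b, c, d` are the regions in their cyclic order around the crossing
and the overcrossing strand separates `a` from `b` and `c` from `d`. -/
def relator (i : ZMod (2 * n)) : FreeGroup D.Region :=
  FreeGroup.of (D.regionAt i .left) * (FreeGroup.of (D.regionAt (i + 1) .left))⁻¹ *
    FreeGroup.of (D.regionAt (i + 1) .right) * (FreeGroup.of (D.regionAt i .right))⁻¹

/-- One relator for each crossing. -/
def relators : Set (FreeGroup D.Region) := {r | ∃ i, D.isOver i = false ∧ r = D.relator i}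

/-- The group of the augmented Dehn presentation: one generator for each region, including the
unbounded one, and one relator for each crossing. -/
abbrev AugmentedGroup : Type := PresentedGroup D.relators

/-- Words in the generators and their inverses; `(r, true)` is `X_r`, `(r, false)` is `X_r⁻¹`. -/
abbrev Word : Type := List (D.Region × Bool)

/-- The element of the augmented group that a word represents. -/
def eval (w : D.Word) : D.AugmentedGroup := PresentedGroup.mk D.relators (FreeGroup.mk w)

/-- A word is geodesic if no word that represents the same element is shorter. -/
def IsGeodesicWord (w : D.Word) : Prop :=
  ∀ w' : D.Word, D.eval w' = D.eval w → w.length ≤ w'.length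

/-- The generator of the augmented group given by the region on side `s` of edge `k`: a loop from
the base point above the plane that goes down through this region and comes back to the base point
around the whole diagram. -/
def gen (k : ZMod (2 * n)) (s : Side) : D.AugmentedGroup := PresentedGroup.of (D.regionAt k s)

/-- The longitude `λ`: the blackboard parallel of the knot, based at the base point of the diagram.
It goes once around the diagram, and at each passage under another strand, from a region `a` to a
region `b`, it contributes `X_a X_b⁻¹`. (By the relators, the parallel on the right and the parallel
on the left give the same element.) -/
def longitude : D.AugmentedGroup :=
  ((List.range (2 * n)).map fun k : ℕ =>
    if D.isOver k then 1 else D.gen k .left * (D.gen (k + 1) .left)⁻¹).prod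

/-- The meridian `μ` at the base point: it goes down on the right of the strand and comes up on its
left, so it is oriented by the right-hand rule (linking number `1` with the oriented knot). -/
def meridian : D.AugmentedGroup := D.gen 0 .right * (D.gen 0 .left)⁻¹

/-- Elements of the form `λ ^ a * μ ^ b`. -/
def IsPeripheral (g : D.AugmentedGroup) : Prop :=
  ∃ a b : ℤ, g = D.longitude ^ a * D.meridian ^ b

open Classical in
/-- The peripheral word problem: given a word, decide whether it represents a peripheral element. -/
noncomputable def peripheralWordProblem (w : D.Word) : Bool := decide (D.IsPeripheral (D.eval w))

/-! ### The peripheral complex -/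

/-- The first undercrossing passage after the base point (of an alternating diagram). -/
def firstUnder : ZMod (2 * n) := if D.isOver 0 then 1 else 0

/-- A labelled unit square in the plane. -/
structure Square where
  bottom : D.Region
  right : D.Region
  top : D.Region
  left : D.Region

/-- The side of the knot that labels the bottom edge of square number `k`, if the bottom edge of
square number `0` is labelled from the side `s`. -/
def sideAt (s : Side) (k : ℤ) : Side := if Even k then s else s.flip

/-- The relator square number `k`, placed in the plane, of the `k`-th crossing met after the first
undercrossing (which has number `0`). Its corners at this crossing are in the cyclic order
`bottom, right, top, left`. The first square can be placed in two ways, such that the path along its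
bottom and its right edge follows the knot through the undercrossing: its bottom edge is labelled by
the region behind the crossing on the side `s`, where `s` may be `left` or `right`. The other squares
are then determined by gluing the left edge of the next square to the right edge of the previous one
(`square_right`). -/
def square (s : Side) (k : ℤ) : D.Square where
  bottom := D.regionAt (D.firstUnder + k) (sideAt s k)
  right := D.regionAt (D.firstUnder + k + 1) (sideAt s k)
  top := D.regionAt (D.firstUnder + k + 1) (sideAt s k).flip
  left := D.regionAt (D.firstUnder + k) (sideAt s k).flip

theorem flip_sideAt (s : Side) (k : ℤ) : (sideAt s k).flip = sideAt s (k + 1) := by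
  by_cases h : Even k <;> cases s <;> simp [sideAt, h, Side.flip]

/-- The right edge of each square is the left edge of the next one. -/
theorem square_right (s : Side) (k : ℤ) : (D.square s k).right = (D.square s (k + 1)).left := by
  simp only [square, ← flip_sideAt]
  cases sideAt s k <;> simp [Side.flip, add_assoc]

/-- The top edge of each square is the bottom edge of the next one, so that each row of the tiling
is the row below it, moved to the left by one square. -/
theorem square_top (s : Side) (k : ℤ) : (D.square s k).top = (D.square s (k + 1)).bottom := by
  simp only [square, ← flip_sideAt]
  simp [add_assoc]

/-- The squares repeat after `2 n` steps: the squares `0, …, 2 n - 1` form a fundamental block. -/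
theorem square_periodic (s : Side) (k : ℤ) : D.square s (k + 2 * n) = D.square s k := by
  have h : ((2 * n : ℕ) : ZMod (2 * n)) = 0 := ZMod.natCast_self _
  push_cast at h
  simp [square, sideAt, h, Int.even_add]

/-- The tile of the peripheral complex with corners `(x, y), (x + 1, y), (x + 1, y + 1), (x, y + 1)`.
The row `y = 0` consists of copies of the fundamental block, placed one after the other. -/
def tile (s : Side) (p : ℤ × ℤ) : D.Square := D.square s (p.1 + p.2)

/-- The edge graph of the tiling of the plane by unit squares with integral corners. -/
noncomputable abbrev grid : SimpleGraph (ℤ × ℤ) := SimpleGraph.hasse ℤ □ SimpleGraph.hasse ℤ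

/-- The letter read along a step of an edge-path of the peripheral complex. Vertices with even
coordinate sum are sources, the others are sinks: a step contributes a generator if it starts at a
source and the inverse of a generator if it starts at a sink. The edge of the step is the bottom edge
or the left edge of the tile whose lower left corner is the smaller endpoint of the step. -/
noncomputable def letter (s : Side) (d : grid.Dart) : D.Region × Bool :=
  (if d.fst.2 = d.snd.2 then (D.tile s (d.fst ⊓ d.snd)).bottom
    else (D.tile s (d.fst ⊓ d.snd)).left,
   decide (Even (d.fst.1 + d.fst.2)))

/-- The word that labels an edge-path of the peripheral complex. -/
noncomputable def pathLabel (s : Side) {u v : ℤ × ℤ} (p : grid.Walk u v) : D.Word := p.darts.map (D.letter s)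

/-- The word `w` labels a geodesic edge-path from `u` to `v` in the peripheral complex. -/
def LabelsGeodesicPath (s : Side) (w : D.Word) (u v : ℤ × ℤ) : Prop :=
  ∃ p : grid.Walk u v, p.length = grid.dist u v ∧ D.pathLabel s p = w

end KnotDiagram

/-!
The presentation complex of the augmented Dehn presentation has one vertex and one square for each
crossing. Planarity gives a checkerboard colouring of the regions (`exists_checkerboard`), and the
regions around a crossing alternate in colour, so the edges of the squares are alternately
"vertical" and "horizontal". Since the diagram is prime, reduced and alternating, two consecutive
edges lie in at most one square (`IsRelatorSquare.unique_of_over`, `unique_of_under`). Therefore the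
rewriting system with the rules
* cancel a letter and its inverse,
* replace the vertical-horizontal half `t x` of a square by its other half `x' t'`

is complete: it terminates, and its critical pairs can be resolved (`Step.locally_confluent`), so
two words represent the same element iff they have a common descendant (`join_of_eval_eq`).

At each vertex of the peripheral complex the four edges belong to the four corners at one crossing.
They have different labels, and with two consecutive edges of a relator square the plane contains
this square (`isLocallyConvex_flatEdge`). So all descendants of a word that labels a path of the
plane label paths with the same ends; conversely swaps, but not cancellations, can be undone
inside the plane. Now let `w` be geodesic with value `λ ^ a * μ ^ b`, and let `v` be the label of
any path to the corresponding point. The words `w` and `v` have a common descendant `z`, and `z`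
labels a path of the plane. As `w` is geodesic, `z` is not shorter than `w`, so `w` was reduced to
`z` by swaps only, and `w` labels a path of the plane as well. The other direction holds because the
plane consists of relator squares; the value at the end point is computed in `exists_potential`. The
two placements of the first square give planes that are reflections of each other in the diagonal.

A word is peripheral iff its irreducible descendant labels a path from the origin to a vertex whose
coordinate sum is divisible by `2 * n`, that is, a loop in a finite graph, the quotient torus of the
plane. A machine with two working stacks computes this descendant and then follows its letters
backwards through the finite graph. The number of steps is quadratic, since the reduction takes at
most as many swaps as the word has inversions.
-/

open Relation

/-! ### Rewriting words over the edges of a square complex with two kinds of edges -/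

/-- Relation `r` has a common descendant for any two descendants of a point, if it terminates and
this holds for any two immediate successors (Newman's lemma). -/
theorem Relation.join_of_locally_confluent {α : Type*} {r : α → α → Prop}
    (hwf : WellFounded (flip r))
    (hloc : ∀ a b c, r a b → r a c → Join (ReflTransGen r) b c) {a b c : α}
    (hab : ReflTransGen r a b) (hac : ReflTransGen r a c) : Join (ReflTransGen r) b c := by
  induction a using hwf.induction generalizing b c with
  | _ a ih =>
    rcases hab.cases_head with rfl | ⟨b₁, hb₁, hb⟩
    · exact ⟨c, hac, .refl⟩
    rcases hac.cases_head with rfl | ⟨c₁, hc₁, hc⟩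
    · exact ⟨b, .refl, (ReflTransGen.single hb₁).trans hb⟩
    obtain ⟨d, hbd, hcd⟩ := hloc a b₁ c₁ hb₁ hc₁
    obtain ⟨e, hbe, hde⟩ := ih b₁ hb₁ hb hbd
    obtain ⟨g, hcg, heg⟩ := ih c₁ hc₁ hc (hcd.trans hde)
    exact ⟨g, hbe.trans heg, hcg⟩

/-- The local data of a square complex whose edges are vertical or horizontal, such that two letters
(oriented edges) are consecutive edges of at most one square. `sq t x x' t'` says that there is a
square around which the words `t x` and `x' t'`, with `t, t'` vertical and `x, x'` horizontal, are
the two paths between opposite corners. -/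
structure SwapSystem (α : Type*) where
  /-- the reversed letter -/
  inv : α → α
  inv_inv : ∀ a, inv (inv a) = a
  /-- whether a letter is vertical -/
  vert : α → Bool
  vert_inv : ∀ a, vert (inv a) = vert a
  /-- the squares -/
  sq : α → α → α → α → Prop
  vert_of_sq : ∀ {t x x' t'}, sq t x x' t' →
    vert t = true ∧ vert x = false ∧ vert x' = false ∧ vert t' = true
  sq_unique : ∀ {t x y s y' s'}, sq t x y s → sq t x y' s' → y = y' ∧ s = s'
  sq_rotate_left : ∀ {t x x' t'}, sq t x x' t' → sq (inv t) x' x (inv t')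
  sq_rotate_right : ∀ {t x x' t'}, sq t x x' t' → sq t' (inv x) (inv x') t

namespace SwapSystem

variable {α : Type*} (S : SwapSystem α)

/-- One rewriting step: a letter and its inverse are cancelled, or a horizontal letter is moved
across a square to the front of a vertical one. -/
inductive Step : List α → List α → Prop
  | cancel (a : α) (l : List α) : Step (a :: S.inv a :: l) l
  | swap {t x x' t' : α} (h : S.sq t x x' t') (l : List α) : Step (t :: x :: l) (x' :: t' :: l)
  | cons (a : α) {l l' : List α} (h : Step l l') : Step (a :: l) (a :: l')

/-- Any number of rewriting steps. -/
abbrev Steps : List α → List α → Prop := ReflTransGen S.Step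

variable {S}

/-- The half `x' t'` of a square determines the other half: it is read backwards around the square
from the opposite corner. -/
theorem sq_unique' {t x t₁ x₁ y s : α} (h : S.sq t x y s) (h₁ : S.sq t₁ x₁ y s) :
    t = t₁ ∧ x = x₁ := by
  obtain ⟨h₂, h₃⟩ := S.sq_unique (S.sq_rotate_right (S.sq_rotate_left h))
    (S.sq_rotate_right (S.sq_rotate_left h₁))
  have h₄ := congrArg S.inv h₂
  have h₅ := congrArg S.inv h₃
  rw [S.inv_inv, S.inv_inv] at h₄ h₅
  exact ⟨h₅, h₄⟩

theorem Steps.cons (a : α) {l l' : List α} (h : S.Steps l l') : S.Steps (a :: l) (a :: l') :=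
  ReflTransGen.lift (a :: ·) (fun _ _ h => Step.cons a h) _ _ h

theorem Step.append_left (u : List α) {l l' : List α} (h : S.Step l l') :
    S.Step (u ++ l) (u ++ l') := by
  induction u with
  | nil => exact h
  | cons a u ih => exact .cons a ih

theorem Step.append_right (u : List α) {l l' : List α} (h : S.Step l l') :
    S.Step (l ++ u) (l' ++ u) := by
  induction h with
  | cancel a l => exact .cancel a _
  | swap h l => exact .swap h _
  | cons a _ ih => exact .cons a ih

theorem Steps.append {u u' v v' : List α} (hu : S.Steps u u') (hv : S.Steps v v') :
    S.Steps (u ++ v) (u' ++ v') :=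
  (ReflTransGen.lift (· ++ v) (fun _ _ h => Step.append_right v h) _ _ hu).trans
    (ReflTransGen.lift (u' ++ ·) (fun _ _ h => Step.append_left u' h) _ _ hv)

variable (S)

/-- The number of pairs of a vertical letter and a horizontal letter behind it. -/
def inversions (l : List α) : ℕ :=
  match l with
  | [] => 0
  | a :: l => (if S.vert a then l.countP (fun b => !S.vert b) else 0) + inversions l

theorem inversions_append (u v : List α) : S.inversions (u ++ v) =
    S.inversions u + S.inversions v + u.countP S.vert * v.countP (fun b => !S.vert b) := by
  induction u with
  | nil => simp [inversions]
  | cons a u ih =>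
    simp only [List.cons_append, inversions, ih, List.countP_append, List.countP_cons]
    cases S.vert a
    · simp
    · simp; ring

theorem inversions_le (l : List α) : S.inversions l ≤ l.length ^ 2 := by
  induction l with
  | nil => simp [inversions]
  | cons a l ih =>
    have : l.countP (fun b => !S.vert b) ≤ l.length := List.countP_le_length
    simp only [inversions, List.length_cons]
    split_ifs <;> nlinarith

theorem inversions_cancel (a : α) (l : List α) :
    S.inversions l ≤ S.inversions (a :: S.inv a :: l) := by
  simp only [inversions]; omega

variable {S}

theorem inversions_swap {t x x' t' : α} (h : S.sq t x x' t') (l : List α) :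
    S.inversions (t :: x :: l) = S.inversions (x' :: t' :: l) + 1 := by
  obtain ⟨h₁, h₂, h₃, h₄⟩ := S.vert_of_sq h
  simp only [inversions, h₁, h₂, h₃, h₄, List.countP_cons]
  simp
  ring

theorem Step.countP_le {l l' : List α} (h : S.Step l l') :
    l'.countP (fun b => !S.vert b) ≤ l.countP (fun b => !S.vert b) := by
  induction h with
  | cancel a l => simp only [List.countP_cons]; omega
  | swap h l =>
    obtain ⟨h₁, h₂, h₃, h₄⟩ := S.vert_of_sq h
    simp [h₁, h₂, h₃, h₄]
  | cons a h ih => simp only [List.countP_cons]; omega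

theorem Step.length_le {l l' : List α} (h : S.Step l l') : l'.length ≤ l.length := by
  induction h with
  | cancel a l => simp only [List.length_cons]; omega
  | swap h l => simp
  | cons a h ih => simpa using ih

theorem Steps.length_le {l l' : List α} (h : S.Steps l l') : l'.length ≤ l.length := by
  induction h with
  | refl => exact le_rfl
  | tail _ h ih => exact h.length_le.trans ih

theorem Step.lt {l l' : List α} (h : S.Step l l') :
    l'.length + S.inversions l' < l.length + S.inversions l := by
  induction h with
  | cancel a l =>
    have := S.inversions_cancel a l
    simp only [List.length_cons]; omega
  | swap h l =>
    have := inversions_swap h l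
    simp only [List.length_cons]; omega
  | cons a h ih =>
    have := h.countP_le
    simp only [List.length_cons, inversions]
    split_ifs <;> omega

theorem wellFounded_step : WellFounded (flip S.Step) :=
  Subrelation.wf (r := InvImage (· < ·) fun l : List α => l.length + S.inversions l)
    (fun h => h.lt) (InvImage.wf _ Nat.lt_wfRel.wf)

/-- The critical pairs are a cancelling pair that overlaps another one or a swap. In the latter case
the two squares to be used are the rotations of one square. -/
theorem Step.locally_confluent {l u v : List α} (hu : S.Step l u) (hv : S.Step l v) :
    Join S.Steps u v := by
  induction hu generalizing v with
  | cancel a l =>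
    generalize hm : a :: S.inv a :: l = m at hv
    cases hv with
    | cancel b k =>
      obtain ⟨rfl, -, rfl⟩ := by simpa using hm
      exact ⟨_, .refl, .refl⟩
    | swap h k =>
      obtain ⟨rfl, rfl, rfl⟩ := by simpa using hm
      obtain ⟨h₁, h₂, -⟩ := S.vert_of_sq h
      simp [S.vert_inv, h₁] at h₂
    | cons b h =>
      obtain ⟨rfl, rfl⟩ := by simpa using hm
      generalize hm' : S.inv a :: l = m' at h
      cases h with
      | cancel c k =>
        obtain ⟨rfl, rfl⟩ := by simpa using hm'
        rw [S.inv_inv]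
        exact ⟨_, .refl, .refl⟩
      | @swap t x x' t' h k =>
        obtain ⟨rfl, rfl⟩ := by simpa using hm'
        have h₁ := S.sq_rotate_left h
        rw [S.inv_inv] at h₁
        refine ⟨_, .refl, .head (.swap h₁ _) (.single (.cons _ ?_))⟩
        have h₂ := Step.cancel (S := S) (S.inv t') k
        rwa [S.inv_inv] at h₂
      | cons c h =>
        obtain ⟨rfl, rfl⟩ := by simpa using hm'
        exact ⟨_, .single h, .single (.cancel _ _)⟩
  | @swap t x x' t' h l =>
    generalize hm : t :: x :: l = m at hv
    cases hv with
    | cancel b k =>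
      obtain ⟨rfl, rfl, rfl⟩ := by simpa using hm
      obtain ⟨h₁, h₂, -⟩ := S.vert_of_sq h
      simp [S.vert_inv, h₁] at h₂
    | swap h' k =>
      obtain ⟨rfl, rfl, rfl⟩ := by simpa using hm
      obtain ⟨rfl, rfl⟩ := S.sq_unique h h'
      exact ⟨_, .refl, .refl⟩
    | cons b h' =>
      obtain ⟨rfl, rfl⟩ := by simpa using hm
      generalize hm' : x :: l = m' at h'
      cases h' with
      | cancel c k =>
        obtain ⟨rfl, rfl⟩ := by simpa using hm'
        refine ⟨_, .head (.cons _ (.swap (S.sq_rotate_right h) _)) (.single ?_), .refl⟩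
        exact .cancel _ _
      | swap h₂ k =>
        obtain ⟨rfl, rfl⟩ := by simpa using hm'
        have h₃ := (S.vert_of_sq h).2.1
        simp [(S.vert_of_sq h₂).1] at h₃
      | cons c h₂ =>
        obtain ⟨rfl, rfl⟩ := by simpa using hm'
        exact ⟨_, .single (.cons _ (.cons _ h₂)), .single (.swap h _)⟩
  | @cons a l l' h ih =>
    generalize hm : a :: l = m at hv
    cases hv with
    | cancel b k =>
      obtain ⟨rfl, rfl⟩ := by simpa using hm
      generalize hm' : S.inv a :: v = m' at h
      cases h with
      | cancel c k =>
        obtain ⟨rfl, rfl⟩ := by simpa using hm'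
        rw [S.inv_inv]
        exact ⟨_, .refl, .refl⟩
      | @swap t x x' t' h k =>
        obtain ⟨rfl, rfl⟩ := by simpa using hm'
        have h₁ := S.sq_rotate_left h
        rw [S.inv_inv] at h₁
        refine ⟨_, .head (.swap h₁ _) (.single (.cons _ ?_)), .refl⟩
        have h₂ := Step.cancel (S := S) (S.inv t') k
        rwa [S.inv_inv] at h₂
      | cons c h =>
        obtain ⟨rfl, rfl⟩ := by simpa using hm'
        exact ⟨_, .single (.cancel _ _), .single h⟩
    | swap h' k =>
      obtain ⟨rfl, rfl⟩ := by simpa using hm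
      rename_i x x' t'
      generalize hm' : x :: k = m' at h
      cases h with
      | cancel c k =>
        obtain ⟨rfl, rfl⟩ := by simpa using hm'
        refine ⟨_, .refl, .head (.cons _ (.swap (S.sq_rotate_right h') _)) (.single ?_)⟩
        exact .cancel _ _
      | swap h₂ k =>
        obtain ⟨rfl, rfl⟩ := by simpa using hm'
        have h₃ := (S.vert_of_sq h').2.1
        simp [(S.vert_of_sq h₂).1] at h₃
      | cons c h₂ =>
        obtain ⟨rfl, rfl⟩ := by simpa using hm'
        exact ⟨_, .single (.swap h' _), .single (.cons _ (.cons _ h₂))⟩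
    | cons b h' =>
      obtain ⟨rfl, rfl⟩ := by simpa using hm
      obtain ⟨d, h₁, h₂⟩ := ih h'
      exact ⟨_, h₁.cons a, h₂.cons a⟩

theorem Steps.join {l u v : List α} (hu : S.Steps l u) (hv : S.Steps l v) : Join S.Steps u v :=
  Relation.join_of_locally_confluent wellFounded_step (fun _ _ _ h h' => h.locally_confluent h')
    hu hv

variable (S)

/-- The congruence on the free monoid that identifies words with a common descendant. -/
def joinCon : Con (FreeMonoid α) where
  r u v := Join S.Steps u.toList v.toList
  iseqv := (equivalence_join (r := S.Steps) fun _ _ _ h h' => h.join h').comap FreeMonoid.toList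
  mul' := by
    rintro u u' v v' ⟨x, h₁, h₂⟩ ⟨y, h₃, h₄⟩
    exact ⟨x ++ y, by simpa using h₁.append h₃, by simpa using h₂.append h₄⟩

/-! ### Words that label paths -/

variable {S} {V : Type*}

/-- The word `w` labels a path from `p` to `q` in the graph with the labelled edges `E`. -/
inductive LabelsPath (E : V → α → V → Prop) : V → List α → V → Prop
  | nil (p : V) : LabelsPath E p [] p
  | cons {p q r : V} {a : α} {w : List α} (h : E p a q) (hw : LabelsPath E q w r) :
      LabelsPath E p (a :: w) r

theorem LabelsPath.append {E : V → α → V → Prop} {p q r : V} {u v : List α}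
    (hu : LabelsPath E p u q) (hv : LabelsPath E q v r) : LabelsPath E p (u ++ v) r := by
  induction hu with
  | nil p => exact hv
  | cons h _ ih => exact .cons h (ih hv)

theorem labelsPath_append_iff {E : V → α → V → Prop} {p r : V} {u v : List α} :
    LabelsPath E p (u ++ v) r ↔ ∃ q, LabelsPath E p u q ∧ LabelsPath E q v r := by
  refine ⟨fun h => ?_, fun ⟨q, hu, hv⟩ => hu.append hv⟩
  induction u generalizing p with
  | nil => exact ⟨p, .nil p, h⟩
  | cons a u ih =>
    cases h with
    | cons h hw =>
      obtain ⟨q, h₁, h₂⟩ := ih hw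
      exact ⟨q, .cons h h₁, h₂⟩

/-- A labelled graph that is locally convex in the square complex: with two consecutive edges of a
square it contains the other two edges. -/
structure IsLocallyConvex (S : SwapSystem α) (E : V → α → V → Prop) : Prop where
  symm : ∀ {p a q}, E p a q → E q (S.inv a) p
  unique : ∀ {p a q q'}, E p a q → E p a q' → q = q'
  sq : ∀ {t x x' t' p q r}, S.sq t x x' t' → E p t q → E q x r → ∃ q', E p x' q' ∧ E q' t' r
  sq' : ∀ {t x x' t' p q r}, S.sq t x x' t' → E p x' q → E q t' r → ∃ q', E p t q' ∧ E q' x r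

namespace IsLocallyConvex

variable {E : V → α → V → Prop}

theorem labelsPath_step (hE : IsLocallyConvex S E) {u v : List α} (h : S.Step u v) {p q : V}
    (hp : LabelsPath E p u q) :
    LabelsPath E p v q := by
  induction h generalizing p with
  | cancel a l =>
    cases hp with
    | cons h₁ hp =>
      cases hp with
      | cons h₂ hp => rwa [← hE.unique h₂ (hE.symm h₁)]
  | swap h l =>
    cases hp with
    | cons h₁ hp =>
      cases hp with
      | cons h₂ hp =>
        obtain ⟨q', h₃, h₄⟩ := hE.sq h h₁ h₂
        exact .cons h₃ (.cons h₄ hp)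
  | cons a _ ih =>
    cases hp with
    | cons h₁ hp => exact .cons h₁ (ih hp)

theorem labelsPath_of_step (hE : IsLocallyConvex S E) {u v : List α} (h : S.Step u v)
    (hl : v.length = u.length) {p q : V} (hp : LabelsPath E p v q) : LabelsPath E p u q := by
  induction h generalizing p with
  | cancel a l => simp only [List.length_cons] at hl; omega
  | swap h l =>
    cases hp with
    | cons h₁ hp =>
      cases hp with
      | cons h₂ hp =>
        obtain ⟨q', h₃, h₄⟩ := hE.sq' h h₁ h₂
        exact .cons h₃ (.cons h₄ hp)
  | cons a _ ih =>
    cases hp with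
    | cons h₁ hp => exact .cons h₁ (ih (by simpa using hl) hp)

theorem labelsPath_steps (hE : IsLocallyConvex S E) {u v : List α} (h : S.Steps u v) {p q : V}
    (hp : LabelsPath E p u q) :
    LabelsPath E p v q := by
  induction h with
  | refl => exact hp
  | tail _ h ih => exact hE.labelsPath_step h ih

/-- A reduction that preserves the length consists of swaps only, and these can be undone inside a
locally convex subgraph. -/
theorem labelsPath_of_steps (hE : IsLocallyConvex S E) {u v : List α} (h : S.Steps u v)
    (hl : v.length = u.length) {p q : V} (hp : LabelsPath E p v q) : LabelsPath E p u q := by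
  induction h using ReflTransGen.head_induction_on with
  | refl => exact hp
  | head h₁ h₂ ih =>
    have h₃ := h₁.length_le
    have h₄ := Steps.length_le h₂
    exact hE.labelsPath_of_step h₁ (by omega) (ih (by omega))

end IsLocallyConvex

end SwapSystem

namespace KnotDiagram

variable {n : ℕ} (D : KnotDiagram n)

/-! ### The regions around a crossing -/

theorem neZero_two_mul (D : KnotDiagram n) : NeZero (2 * n) := ⟨by have := D.crossings_pos; omega⟩

instance : Finite D.Region := by
  have := D.neZero_two_mul
  have : Finite Side := .of_surjective (fun b : Bool => if b then Side.left else .right) (by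
    rintro (_ | _)
    exacts [⟨true, rfl⟩, ⟨false, rfl⟩])
  exact inferInstanceAs (Finite (Quot _))

theorem _root_.Side.flip_flip (s : Side) : s.flip.flip = s := by cases s <;> rfl

theorem forall_regionAt {P : D.Region → Prop} (h : ∀ k s, P (D.regionAt k s)) (r : D.Region) :
    P r := by
  obtain ⟨⟨k, s⟩, rfl⟩ := Quot.exists_rep r
  exact h k s

/-- The corners at a crossing, seen along a passage over which the other strand crosses from right
to left. -/
theorem corners_of_fromRight {i : ZMod (2 * n)} (h : D.fromRight i = true) :
    D.regionAt i .left = D.regionAt (D.partner i + 1) .left ∧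
    D.regionAt (i + 1) .left = D.regionAt (D.partner i + 1) .right ∧
    D.regionAt i .right = D.regionAt (D.partner i) .left ∧
    D.regionAt (i + 1) .right = D.regionAt (D.partner i) .right :=
  ⟨Quot.sound (.southWest i h), Quot.sound (.northWest i h), Quot.sound (.southEast i h),
    Quot.sound (.northEast i h)⟩

/-- The corners at a crossing, seen along a passage over which the other strand crosses from left
to right. -/
theorem corners_of_not_fromRight {i : ZMod (2 * n)} (h : D.fromRight i = false) :
    D.regionAt i .left = D.regionAt (D.partner i) .right ∧
    D.regionAt (i + 1) .left = D.regionAt (D.partner i) .left ∧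
    D.regionAt i .right = D.regionAt (D.partner i + 1) .right ∧
    D.regionAt (i + 1) .right = D.regionAt (D.partner i + 1) .left := by
  have h' : D.fromRight (D.partner i) = true := by rw [D.fromRight_partner, h]; rfl
  obtain ⟨h₁, h₂, h₃, h₄⟩ := D.corners_of_fromRight h'
  rw [D.partner_partner] at h₁ h₂ h₃ h₄
  exact ⟨h₃.symm, h₁.symm, h₄.symm, h₂.symm⟩

/-- For a passage `i`, the regions on the same side of the edges `i` and `i + 1` are the two regions
beside one of the two edges of the other strand at this crossing. -/
theorem exists_crossing_edge (i : ZMod (2 * n)) : ∃ t : Side, ∀ s : Side,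
    (D.regionAt i s = D.regionAt (D.partner i) t ∧
      D.regionAt (i + 1) s = D.regionAt (D.partner i) t.flip ∧
      D.regionAt (i + 1) s.flip = D.regionAt (D.partner i + 1) t.flip ∧
      D.regionAt i s.flip = D.regionAt (D.partner i + 1) t) ∨
    (D.regionAt i s = D.regionAt (D.partner i + 1) t ∧
      D.regionAt (i + 1) s = D.regionAt (D.partner i + 1) t.flip ∧
      D.regionAt (i + 1) s.flip = D.regionAt (D.partner i) t.flip ∧
      D.regionAt i s.flip = D.regionAt (D.partner i) t) := by
  rcases h : D.fromRight i with _ | _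
  · obtain ⟨h₁, h₂, h₃, h₄⟩ := D.corners_of_not_fromRight h
    refine ⟨.right, fun s => ?_⟩
    cases s
    · exact .inl ⟨h₁, h₂, h₄, h₃⟩
    · exact .inr ⟨h₃, h₄, h₂, h₁⟩
  · obtain ⟨h₁, h₂, h₃, h₄⟩ := D.corners_of_fromRight h
    refine ⟨.left, fun s => ?_⟩
    cases s
    · exact .inr ⟨h₁, h₂, h₄, h₃⟩
    · exact .inl ⟨h₃, h₄, h₂, h₁⟩

/-! ### The checkerboard colouring -/

theorem eq_of_forall_succ (D : KnotDiagram n) {α : Type*} (g : ZMod (2 * n) → α)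
    (h : ∀ i, g (i + 1) = g i) (k : ZMod (2 * n)) : g k = g 0 := by
  have hn := D.neZero_two_mul
  have : ∀ m : ℕ, g m = g 0 := by
    intro m
    induction m with
    | zero => simp
    | succ m ih => rw [Nat.cast_succ, h, ih]
  simpa using this k.val

/-- The dual graph of the diagram is connected. -/
theorem eq_of_regionAt_left_eq_right {α : Type*} (c : D.Region → α)
    (h : ∀ k, c (D.regionAt k .left) = c (D.regionAt k .right)) (r r' : D.Region) :
    c r = c r' := by
  have h₀ : ∀ k s, c (D.regionAt k s) = c (D.regionAt k .left) := by
    rintro k (_ | _)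
    exacts [rfl, (h k).symm]
  have h₁ : ∀ k, c (D.regionAt (k + 1) .left) = c (D.regionAt k .left) := by
    intro i
    obtain ⟨t, ht⟩ := D.exists_crossing_edge i
    rcases ht .left with ⟨h₁, h₂, -⟩ | ⟨h₁, h₂, -⟩ <;> rw [h₁, h₂, h₀, h₀ _ t]
  have h₂ : ∀ r, c r = c (D.regionAt 0 .left) := D.forall_regionAt fun k s => by
    rw [h₀, D.eq_of_forall_succ (fun k => c (D.regionAt k .left)) h₁]
  rw [h₂, h₂ r']

/-- The crossings, named by their undercrossing passages. -/
abbrev Crossing : Type := {i : ZMod (2 * n) // D.isOver i = false}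

/-- The crossing through which a passage goes. -/
def crossingAt (i : ZMod (2 * n)) : D.Crossing :=
  if h : D.isOver i = false then ⟨i, h⟩
  else ⟨D.partner i, by rw [D.isOver_partner]; simpa using h⟩

theorem crossingAt_partner (i : ZMod (2 * n)) : D.crossingAt (D.partner i) = D.crossingAt i := by
  have h := D.isOver_partner i
  unfold crossingAt
  by_cases h' : D.isOver i = false <;> simp_all [D.partner_partner]

theorem crossingAt_val (i : D.Crossing) : D.crossingAt i.1 = i := by
  simp [crossingAt, i.2]

theorem card_crossing : Nat.card D.Crossing = n := by
  have hn := D.neZero_two_mul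
  let e : D.Crossing ≃ {i : ZMod (2 * n) // ¬ D.isOver i = false} :=
    { toFun := fun i => ⟨D.partner i.1, by rw [D.isOver_partner, i.2]; simp⟩
      invFun := fun i => ⟨D.partner i.1, by rw [D.isOver_partner]; simpa using i.2⟩
      left_inv := fun i => Subtype.ext (D.partner_partner _)
      right_inv := fun i => Subtype.ext (D.partner_partner _) }
  have h₁ := Nat.card_congr (Equiv.sumCompl fun i : ZMod (2 * n) => D.isOver i = false)
  rw [Nat.card_sum, ← Nat.card_congr e, Nat.card_zmod] at h₁
  have : Nat.card D.Crossing = Nat.card {i : ZMod (2 * n) // D.isOver i = false} := rfl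
  omega

/-- The coboundary of a set of regions: the set of the edges with exactly one side in it. -/
def regionCoboundary : (D.Region → ZMod 2) →ₗ[ZMod 2] (ZMod (2 * n) → ZMod 2) where
  toFun c k := c (D.regionAt k .left) + c (D.regionAt k .right)
  map_add' c c' := by ext k; simp only [Pi.add_apply]; ring
  map_smul' a c := by ext k; simp only [Pi.smul_apply, smul_eq_mul, RingHom.id_apply]; ring

open Classical in
/-- The boundary of a set of edges of the diagram: the set of the crossings at which an odd number
of its edge ends lie. Edge `k` comes from passage `k - 1` and leads to passage `k`. -/
noncomputable def edgeBoundary [NeZero (2 * n)] :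
    (ZMod (2 * n) → ZMod 2) →ₗ[ZMod 2] (D.Crossing → ZMod 2) :=
  Fintype.linearCombination (ZMod 2) fun k =>
    Pi.single (D.crossingAt k) 1 + Pi.single (D.crossingAt (k - 1)) 1

open Classical in
theorem edgeBoundary_apply [NeZero (2 * n)] (v : ZMod (2 * n) → ZMod 2) :
    D.edgeBoundary v = ∑ k, (v k + v (k + 1)) • Pi.single (D.crossingAt k) (1 : ZMod 2) := by
  simp only [edgeBoundary, Fintype.linearCombination_apply, smul_add, add_smul,
    Finset.sum_add_distrib]
  congr 1
  refine Fintype.sum_equiv (Equiv.subRight 1) _ _ fun k => ?_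
  simp

theorem zmod_two_add_self (a : ZMod 2) : a + a = 0 := CharTwo.add_self_eq_zero a

/-- The four corners at a crossing are each counted twice. -/
theorem edgeBoundary_regionCoboundary [NeZero (2 * n)] (c : D.Region → ZMod 2) :
    D.edgeBoundary (D.regionCoboundary c) = 0 := by
  classical
  rw [edgeBoundary_apply]
  refine Finset.sum_involution (fun i _ => D.partner i) (fun i _ => ?_)
    (fun i _ _ => D.partner_ne i) (fun i _ => Finset.mem_univ _) (fun i _ => D.partner_partner i)
  rw [D.crossingAt_partner, ← add_smul]
  convert zero_smul (ZMod 2) _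
  simp only [regionCoboundary, LinearMap.coe_mk, AddHom.coe_mk]
  obtain ⟨t, ht⟩ := D.exists_crossing_edge i
  have h₁ : ∀ j, c (D.regionAt j t) + c (D.regionAt j t.flip) =
      c (D.regionAt j .left) + c (D.regionAt j .right) := fun j => by
    cases t
    exacts [rfl, add_comm _ _]
  rw [← h₁ (D.partner i), ← h₁ (D.partner i + 1)]
  rcases ht .left with ⟨h₂, h₃, h₄, h₅⟩ | ⟨h₂, h₃, h₄, h₅⟩ <;>
  · rw [Side.flip] at h₄ h₅
    rw [h₂, h₃, h₄, h₅]
    ring_nf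
    have h2 : (2 : ZMod 2) = 0 := rfl
    simp [h2]

/-- Walking along the knot, one sees that all crossings are homologous, so the boundaries of edges
and one crossing span the space of all sets of crossings. -/
theorem finrank_range_edgeBoundary [NeZero (2 * n)] :
    n ≤ Module.finrank (ZMod 2) (LinearMap.range D.edgeBoundary) + 1 := by
  classical
  set e : Submodule (ZMod 2) (D.Crossing → ZMod 2) :=
    Submodule.span (ZMod 2) {Pi.single (D.crossingAt 0) 1} with he
  have h₀ : ∀ m : ℕ, (Pi.single (D.crossingAt m) (1 : ZMod 2) : D.Crossing → ZMod 2) ∈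
      LinearMap.range D.edgeBoundary ⊔ e := by
    intro m
    induction m with
    | zero => exact Submodule.mem_sup_right (Submodule.subset_span (by simp))
    | succ m ih =>
      have h₁ : D.edgeBoundary (Pi.single ((m + 1 : ℕ) : ZMod (2 * n)) 1) ∈
          LinearMap.range D.edgeBoundary ⊔ e := Submodule.mem_sup_left ⟨_, rfl⟩
      have h₂ := Submodule.sub_mem _ h₁ ih
      simpa [edgeBoundary, Fintype.linearCombination_apply_single] using h₂
  have h₁ : (⊤ : Submodule (ZMod 2) (D.Crossing → ZMod 2)) ≤
      LinearMap.range D.edgeBoundary ⊔ e := by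
    rw [← (Pi.basisFun (ZMod 2) D.Crossing).span_eq, Submodule.span_le]
    rintro _ ⟨i, rfl⟩
    have := h₀ i.1.val
    simpa [D.crossingAt_val] using this
  have h₂ := Submodule.finrank_mono h₁
  rw [finrank_top, Module.finrank_fintype_fun_eq_card, ← Nat.card_eq_fintype_card,
    D.card_crossing] at h₂
  have h₃ := Submodule.finrank_add_le_finrank_add_finrank (LinearMap.range D.edgeBoundary) e
  have h₄ : Module.finrank (ZMod 2) e ≤ 1 := by
    simpa using finrank_span_le_card (R := ZMod 2)
      ({Pi.single (D.crossingAt 0) 1} : Set (D.Crossing → ZMod 2))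
  omega

/-- Only constant functions on the regions have a trivial coboundary, and there are `n + 2`
regions. -/
theorem finrank_range_regionCoboundary :
    n + 1 ≤ Module.finrank (ZMod 2) (LinearMap.range D.regionCoboundary) := by
  have := Fintype.ofFinite D.Region
  have h₁ := LinearMap.finrank_range_add_finrank_ker D.regionCoboundary
  rw [Module.finrank_fintype_fun_eq_card, ← Nat.card_eq_fintype_card,
    show Nat.card D.Region = n + 2 from D.planar] at h₁
  have h₂ : LinearMap.ker D.regionCoboundary ≤ Submodule.span (ZMod 2) {fun _ => 1} := by
    intro c hc
    rw [LinearMap.mem_ker] at hc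
    refine Submodule.mem_span_singleton.2 ⟨c (D.regionAt 0 .left), ?_⟩
    ext r
    simp only [Pi.smul_apply, smul_eq_mul, mul_one]
    exact D.eq_of_regionAt_left_eq_right c
      (fun k => CharTwo.add_eq_zero.1 (congrFun hc k)) _ _
  have h₃ := Submodule.finrank_mono h₂
  have h₄ : Module.finrank (ZMod 2)
      (Submodule.span (ZMod 2) {(fun _ => 1 : D.Region → ZMod 2)}) ≤ 1 := by
    simpa using finrank_span_le_card (R := ZMod 2) ({fun _ => 1} : Set (D.Region → ZMod 2))
  omega

/-- The regions of a planar diagram have a checkerboard colouring. Indeed, the sequence of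
`regionCoboundary` and `edgeBoundary` is exact, since the diagram is connected and the number of its
regions is `n + 2`, and the boundary of the set of all edges is zero, since four edge ends meet at
each crossing. -/
theorem exists_checkerboard : ∃ c : D.Region → ZMod 2,
    ∀ k, c (D.regionAt k .left) + c (D.regionAt k .right) = 1 := by
  have hn := D.neZero_two_mul
  have h₁ : LinearMap.range D.regionCoboundary ≤ LinearMap.ker D.edgeBoundary := by
    rintro _ ⟨c, rfl⟩
    exact D.edgeBoundary_regionCoboundary c
  have h₂ := LinearMap.finrank_range_add_finrank_ker D.edgeBoundary
  rw [Module.finrank_fintype_fun_eq_card, ZMod.card] at h₂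
  have h₃ := D.finrank_range_edgeBoundary
  have h₄ := D.finrank_range_regionCoboundary
  have h₅ := Submodule.eq_of_le_of_finrank_le h₁ (by omega)
  have h₆ : (fun _ => 1) ∈ LinearMap.ker D.edgeBoundary := by
    rw [LinearMap.mem_ker, edgeBoundary_apply]
    exact Finset.sum_eq_zero fun k _ => by rw [zmod_two_add_self, zero_smul]
  rw [← h₅] at h₆
  obtain ⟨c, hc⟩ := h₆
  exact ⟨c, fun k => congrFun hc k⟩

end KnotDiagram

namespace KnotDiagram

variable {n : ℕ} (D : KnotDiagram n)

/-! ### The relator squares -/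

/-- `X_p X_q⁻¹ X_r X_s⁻¹` is a relator, up to inversion and cyclic permutation. -/
def IsRelatorSquare (p q r s : D.Region) : Prop :=
  ∃ i σ, D.isOver i = false ∧
    ((p = D.regionAt i σ ∧ q = D.regionAt (i + 1) σ ∧ r = D.regionAt (i + 1) σ.flip ∧
        s = D.regionAt i σ.flip) ∨
      (p = D.regionAt (i + 1) σ ∧ q = D.regionAt i σ ∧ r = D.regionAt i σ.flip ∧
        s = D.regionAt (i + 1) σ.flip))

variable {D}

theorem IsRelatorSquare.reverse {p q r s : D.Region} (h : D.IsRelatorSquare p q r s) :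
    D.IsRelatorSquare s r q p := by
  obtain ⟨i, σ, hi, ⟨h₁, h₂, h₃, h₄⟩ | ⟨h₁, h₂, h₃, h₄⟩⟩ := h
  · exact ⟨i, σ.flip, hi, .inl ⟨h₄, h₃, by rwa [σ.flip_flip], by rwa [σ.flip_flip]⟩⟩
  · exact ⟨i, σ.flip, hi, .inr ⟨h₄, h₃, by rwa [σ.flip_flip], by rwa [σ.flip_flip]⟩⟩

theorem IsRelatorSquare.exchange {p q r s : D.Region} (h : D.IsRelatorSquare p q r s) :
    D.IsRelatorSquare q p s r := by
  obtain ⟨i, σ, hi, ⟨h₁, h₂, h₃, h₄⟩ | ⟨h₁, h₂, h₃, h₄⟩⟩ := h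
  · exact ⟨i, σ, hi, .inr ⟨h₂, h₁, h₄, h₃⟩⟩
  · exact ⟨i, σ, hi, .inl ⟨h₂, h₁, h₄, h₃⟩⟩

/-- A relator square in terms of the overcrossing passage. -/
theorem isRelatorSquare_iff_over {p q r s : D.Region} : D.IsRelatorSquare p q r s ↔
    ∃ j τ, D.isOver j = true ∧
      ((p = D.regionAt j τ ∧ q = D.regionAt j τ.flip ∧ r = D.regionAt (j + 1) τ.flip ∧
          s = D.regionAt (j + 1) τ) ∨
        (p = D.regionAt (j + 1) τ ∧ q = D.regionAt (j + 1) τ.flip ∧ r = D.regionAt j τ.flip ∧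
          s = D.regionAt j τ)) := by
  constructor
  · rintro ⟨i, σ, hi, h⟩
    obtain ⟨t, ht⟩ := D.exists_crossing_edge i
    have hj : D.isOver (D.partner i) = true := by rw [D.isOver_partner, hi]; rfl
    rcases ht σ with ⟨h₁, h₂, h₃, h₄⟩ | ⟨h₁, h₂, h₃, h₄⟩ <;> rw [h₁, h₂, h₃, h₄] at h <;>
      rcases h with ⟨h₁, h₂, h₃, h₄⟩ | ⟨h₁, h₂, h₃, h₄⟩
    · exact ⟨_, t, hj, .inl ⟨h₁, h₂, h₃, h₄⟩⟩
    · exact ⟨_, t.flip, hj, .inl ⟨h₁, by rwa [t.flip_flip], by rwa [t.flip_flip], h₄⟩⟩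
    · exact ⟨_, t, hj, .inr ⟨h₁, h₂, h₃, h₄⟩⟩
    · exact ⟨_, t.flip, hj, .inr ⟨h₁, by rwa [t.flip_flip], by rwa [t.flip_flip], h₄⟩⟩
  · rintro ⟨j, τ, hj, h⟩
    obtain ⟨t, ht⟩ := D.exists_crossing_edge j
    have hi : D.isOver (D.partner j) = false := by rw [D.isOver_partner, hj]; rfl
    rcases ht τ with ⟨h₁, h₂, h₃, h₄⟩ | ⟨h₁, h₂, h₃, h₄⟩ <;> rw [h₁, h₂, h₃, h₄] at h <;>
      rcases h with ⟨h₁, h₂, h₃, h₄⟩ | ⟨h₁, h₂, h₃, h₄⟩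
    · exact ⟨_, t, hi, .inl ⟨h₁, h₂, h₃, h₄⟩⟩
    · exact ⟨_, t.flip, hi, .inl ⟨h₁, h₂, by rwa [t.flip_flip], by rwa [t.flip_flip]⟩⟩
    · exact ⟨_, t, hi, .inr ⟨h₁, h₂, h₃, h₄⟩⟩
    · exact ⟨_, t.flip, hi, .inr ⟨h₁, h₂, by rwa [t.flip_flip], by rwa [t.flip_flip]⟩⟩

theorem Reduced.regionAt_ne (hred : D.Reduced) (e : ZMod (2 * n)) (σ : Side) :
    D.regionAt e σ ≠ D.regionAt e σ.flip := by
  have h := hred e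
  simp only [List.nodup_cons, List.mem_cons, not_or] at h
  cases σ
  exacts [h.1.2.2.1, Ne.symm h.1.2.2.1]

/-- A knot edge is determined by the regions on its two sides. -/
theorem Prime.eq_of_regionAt_eq (hprime : D.Prime) (hred : D.Reduced) {e e' : ZMod (2 * n)}
    {σ τ : Side} (h₁ : D.regionAt e σ = D.regionAt e' τ)
    (h₂ : D.regionAt e σ.flip = D.regionAt e' τ.flip) : e = e' ∧ σ = τ := by
  have h : e = e' := by
    by_contra hne
    apply hprime e e' hne
    cases σ <;> cases τ <;> simp only [Side.flip] at h₁ h₂ <;> rw [h₁, h₂] <;>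
      first | rfl | exact Sym2.eq_swap
  subst h
  refine ⟨rfl, ?_⟩
  have := hred.regionAt_ne e
  cases σ <;> cases τ <;> first | rfl | exact absurd h₁ (this _)

theorem Alternating.eq_of_succ (halt : D.Alternating) {i j : ZMod (2 * n)}
    (h : D.isOver i = D.isOver j) : i + 1 ≠ j := by
  rintro rfl
  rw [halt] at h
  simp at h

/-- The overcrossing end of a knot edge lies at only one crossing, so two consecutive edges of a
relator square that meet in a sink determine it. -/
theorem IsRelatorSquare.unique_of_over (hprime : D.Prime) (hred : D.Reduced) (halt : D.Alternating)
    {p q r s r' s' : D.Region} (h : D.IsRelatorSquare p q r s)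
    (h' : D.IsRelatorSquare p q r' s') : r = r' ∧ s = s' := by
  obtain ⟨j, τ, hj, h⟩ := isRelatorSquare_iff_over.1 h
  obtain ⟨j', τ', hj', h'⟩ := isRelatorSquare_iff_over.1 h'
  have hjj := hj.trans hj'.symm
  rcases h with ⟨h₁, h₂, rfl, rfl⟩ | ⟨h₁, h₂, rfl, rfl⟩ <;>
    rcases h' with ⟨h₃, h₄, rfl, rfl⟩ | ⟨h₃, h₄, rfl, rfl⟩ <;>
    obtain ⟨h₅, rfl⟩ := hprime.eq_of_regionAt_eq hred (h₁.symm.trans h₃) (h₂.symm.trans h₄)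
  · subst h₅; exact ⟨rfl, rfl⟩
  · exact absurd h₅.symm (halt.eq_of_succ hjj.symm)
  · exact absurd h₅ (halt.eq_of_succ hjj)
  · rw [add_right_cancel h₅]; exact ⟨rfl, rfl⟩

/-- The undercrossing end of a knot edge lies at only one crossing, so two consecutive edges of a
relator square that meet in a source determine it. -/
theorem IsRelatorSquare.unique_of_under (hprime : D.Prime) (hred : D.Reduced)
    (halt : D.Alternating) {p q r s p' s' : D.Region} (h : D.IsRelatorSquare p q r s)
    (h' : D.IsRelatorSquare p' q r s') : p = p' ∧ s = s' := by
  obtain ⟨j, τ, hj, h⟩ := h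
  obtain ⟨j', τ', hj', h'⟩ := h'
  have hjj := hj.trans hj'.symm
  rcases h with ⟨rfl, h₁, h₂, rfl⟩ | ⟨rfl, h₁, h₂, rfl⟩ <;>
    rcases h' with ⟨rfl, h₃, h₄, rfl⟩ | ⟨rfl, h₃, h₄, rfl⟩ <;>
    obtain ⟨h₅, rfl⟩ := hprime.eq_of_regionAt_eq hred (h₁.symm.trans h₃) (h₂.symm.trans h₄)
  · rw [add_right_cancel h₅]; exact ⟨rfl, rfl⟩
  · exact absurd h₅ (halt.eq_of_succ hjj)
  · exact absurd h₅.symm (halt.eq_of_succ hjj.symm)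
  · subst h₅; exact ⟨rfl, rfl⟩

variable (D)

/-- A checkerboard colouring of the regions. -/
noncomputable def colour : D.Region → ZMod 2 := D.exists_checkerboard.choose

theorem colour_add_colour (k : ZMod (2 * n)) (σ : Side) :
    D.colour (D.regionAt k σ) + D.colour (D.regionAt k σ.flip) = 1 := by
  have h := D.exists_checkerboard.choose_spec k
  cases σ
  exacts [h, (add_comm _ _).trans h]

variable {D}

theorem IsRelatorSquare.colour {p q r s : D.Region} (h : D.IsRelatorSquare p q r s) :
    D.colour p = D.colour r ∧ D.colour q = D.colour s ∧ D.colour p + D.colour q = 1 := by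
  have h₁ : D.colour q + D.colour r = 1 ∧ D.colour s + D.colour p = 1 := by
    obtain ⟨i, σ, -, ⟨rfl, rfl, rfl, rfl⟩ | ⟨rfl, rfl, rfl, rfl⟩⟩ := h <;>
      exact ⟨D.colour_add_colour _ _, by rw [add_comm]; exact D.colour_add_colour _ _⟩
  have h₂ : D.colour p + D.colour q = 1 := by
    obtain ⟨j, τ, -, ⟨rfl, rfl, rfl, rfl⟩ | ⟨rfl, rfl, rfl, rfl⟩⟩ := isRelatorSquare_iff_over.1 h
    all_goals exact D.colour_add_colour _ _
  refine ⟨?_, ?_, h₂⟩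
  · linear_combination h₂ - h₁.1
  · linear_combination h₂ - h₁.2

variable (D)

/-! ### The labels of the flat plane -/

/-- The label of the bottom edges of the tiles number `k`, where the first square is placed with the
region on the left of the knot at its bottom edge. -/
def hLabel (k : ℤ) : D.Region := D.regionAt (D.firstUnder + k) (sideAt .left k)

/-- The label of the left edges of the tiles number `k`. -/
def vLabel (k : ℤ) : D.Region := D.regionAt (D.firstUnder + k) (sideAt .left (k + 1))

variable {D}

theorem decide_even_add_one (k : ℤ) : decide (Even (k + 1)) = !decide (Even k) := by
  rw [← decide_not]
  exact decide_eq_decide.2 Int.even_add_one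

theorem sideAt_add_two (s : Side) (k : ℤ) : sideAt s (k + 1 + 1) = sideAt s k := by
  rw [← flip_sideAt, ← flip_sideAt, Side.flip_flip]

theorem Alternating.isOver_firstUnder_add (halt : D.Alternating) (k : ℤ) :
    D.isOver (D.firstUnder + k) = !decide (Even k) := by
  have h : ∀ j : ℤ, D.isOver (D.firstUnder + (j + 1 : ℤ)) = !D.isOver (D.firstUnder + j) := by
    intro j
    push_cast
    rw [← add_assoc, halt]
  induction k with
  | zero =>
    have := halt 0
    unfold firstUnder
    split_ifs <;> simp_all
  | succ k ih => rw [h, ih, decide_even_add_one]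
  | pred k ih =>
    have := h (-k - 1)
    rw [sub_add_cancel, ih] at this
    have h' := decide_even_add_one (-k - 1)
    rw [sub_add_cancel] at h'
    rw [← h', ← Bool.not_not (D.isOver _), ← this, Bool.not_not]

theorem Alternating.isRelatorSquare_of_even (halt : D.Alternating) {k : ℤ} (hk : Even k) :
    D.IsRelatorSquare (D.hLabel k) (D.vLabel (k + 1)) (D.hLabel (k + 1)) (D.vLabel k) := by
  refine ⟨D.firstUnder + k, sideAt .left k, by simp [halt.isOver_firstUnder_add, hk], .inl ?_⟩
  simp only [hLabel, vLabel, flip_sideAt, sideAt_add_two, Int.cast_add, Int.cast_one,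
    ← add_assoc, and_self]

theorem Alternating.isRelatorSquare_of_odd (halt : D.Alternating) {k : ℤ} (hk : ¬ Even k) :
    D.IsRelatorSquare (D.vLabel k) (D.hLabel k) (D.vLabel (k + 1)) (D.hLabel (k + 1)) := by
  refine isRelatorSquare_iff_over.2 ⟨D.firstUnder + k, sideAt .left (k + 1),
    by simp [halt.isOver_firstUnder_add, hk], .inl ?_⟩
  simp only [hLabel, vLabel, flip_sideAt, sideAt_add_two, Int.cast_add, Int.cast_one,
    ← add_assoc, and_self]

theorem colour_hLabel_add_colour_vLabel (k : ℤ) :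
    D.colour (D.hLabel k) + D.colour (D.vLabel k) = 1 := by
  rw [hLabel, vLabel, ← flip_sideAt]
  exact D.colour_add_colour _ _

theorem Alternating.colour_vLabel (halt : D.Alternating) (k : ℤ) :
    D.colour (D.vLabel k) = D.colour (D.vLabel 0) := by
  have h : ∀ k, D.colour (D.vLabel (k + 1)) = D.colour (D.vLabel k) := by
    intro k
    by_cases hk : Even k
    · exact (halt.isRelatorSquare_of_even hk).colour.2.1
    · exact (halt.isRelatorSquare_of_odd hk).colour.1.symm
  induction k with
  | zero => rfl
  | succ k ih => rw [h, ih]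
  | pred k ih => rw [← ih, ← h, sub_add_cancel]

/-- Opposite edges at a vertex of the plane have different labels. -/
theorem Reduced.hLabel_ne_hLabel (hred : D.Reduced) (k : ℤ) :
    D.hLabel k ≠ D.hLabel (k + 1) ∧ D.vLabel k ≠ D.vLabel (k + 1) := by
  have h := hred (D.firstUnder + k)
  simp only [List.nodup_cons, List.mem_cons, not_or] at h
  simp only [hLabel, vLabel, ← flip_sideAt, Int.cast_add, Int.cast_one, ← add_assoc]
  cases sideAt .left k
  · exact ⟨h.1.2.1, fun h' => h.2.1.2.1 h'.symm⟩
  · exact ⟨fun h' => h.2.1.2.1 h'.symm, h.1.2.1⟩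

/-! ### The rewriting system of an alternating diagram -/

variable (D)

/-- Two letters `t x` that are the first half of a relator square whose other half, read from the
same corner, is `x' t'`. -/
inductive IsLetterSquare : D.Region × Bool → D.Region × Bool → D.Region × Bool →
    D.Region × Bool → Prop
  | source {p q r s : D.Region} (h : D.IsRelatorSquare p q r s) :
      IsLetterSquare (p, true) (q, false) (s, true) (r, false)
  | sink {p q r s : D.Region} (h : D.IsRelatorSquare p q r s) :
      IsLetterSquare (q, false) (r, true) (p, false) (s, true)

/-- The colour that the labels of the vertical edges of the flat plane have. -/
noncomputable def isVert (a : D.Region × Bool) : Bool :=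
  decide (D.colour a.1 = D.colour (D.vLabel 0))

theorem isVert_of_add {p q : D.Region} (h : D.colour p + D.colour q = 1) (b c : Bool) :
    D.isVert (p, b) = !D.isVert (q, c) := by
  simp only [isVert]
  generalize D.colour p = x at *
  generalize D.colour q = y at *
  generalize D.colour (D.vLabel 0) = z
  revert x y z
  decide

variable {D}

/-- The rewriting system given by the relator squares and the checkerboard colouring. -/
noncomputable def swapSystem (hprime : D.Prime) (hred : D.Reduced) (halt : D.Alternating) :
    SwapSystem (D.Region × Bool) where
  inv a := (a.1, !a.2)
  inv_inv a := by simp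
  vert := D.isVert
  vert_inv a := rfl
  sq t x x' t' := D.isVert t = true ∧ D.IsLetterSquare t x x' t'
  vert_of_sq := by
    rintro t x x' t' ⟨ht, h⟩
    cases h with
    | @source p q r s h =>
      have h₁ := D.isVert_of_add h.colour.2.2 true false
      have h₂ := D.isVert_of_add h.reverse.colour.2.2 true false
      have h₃ : D.isVert (r, false) = D.isVert (p, true) := by simp [isVert, h.colour.1]
      simp_all
    | @sink p q r s h =>
      have h₁ := D.isVert_of_add h.colour.2.2 false false
      have h₂ := D.isVert_of_add h.reverse.colour.2.2 true true
      have h₃ : D.isVert (s, true) = D.isVert (q, false) := by simp [isVert, h.colour.2.1]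
      simp_all
  sq_unique := by
    rintro t x y s y' s' ⟨-, h⟩ ⟨-, h'⟩
    cases h with
    | source h =>
      cases h' with
      | source h' =>
        obtain ⟨rfl, rfl⟩ := h.unique_of_over hprime hred halt h'
        exact ⟨rfl, rfl⟩
    | sink h =>
      cases h' with
      | sink h' =>
        obtain ⟨rfl, rfl⟩ := h.unique_of_under hprime hred halt h'
        exact ⟨rfl, rfl⟩
  sq_rotate_left := by
    rintro t x x' t' ⟨ht, h⟩
    refine ⟨ht, ?_⟩
    cases h with
    | source h => exact .sink h.exchange
    | sink h => exact .source h.exchange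
  sq_rotate_right := by
    rintro t x x' t' ⟨ht, h⟩
    cases h with
    | source h => exact ⟨by simpa [isVert, h.colour.1] using ht, .sink h.reverse⟩
    | sink h => exact ⟨by simpa [isVert, h.colour.2.1] using ht, .source h.reverse⟩

variable (D) in
/-- The labelled edges of the flat plane. -/
inductive FlatEdge : ℤ × ℤ → D.Region × Bool → ℤ × ℤ → Prop
  | right (x y : ℤ) : FlatEdge (x, y) (D.hLabel (x + y), decide (Even (x + y))) (x + 1, y)
  | left (x y : ℤ) : FlatEdge (x + 1, y) (D.hLabel (x + y), !decide (Even (x + y))) (x, y)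
  | up (x y : ℤ) : FlatEdge (x, y) (D.vLabel (x + y), decide (Even (x + y))) (x, y + 1)
  | down (x y : ℤ) : FlatEdge (x, y + 1) (D.vLabel (x + y), !decide (Even (x + y))) (x, y)

theorem Alternating.isVert_vLabel (halt : D.Alternating) (k : ℤ) (b : Bool) :
    D.isVert (D.vLabel k, b) = true := by
  simp [isVert, halt.colour_vLabel k]

theorem Alternating.isVert_hLabel (halt : D.Alternating) (k : ℤ) (b : Bool) :
    D.isVert (D.hLabel k, b) = false := by
  rw [D.isVert_of_add (colour_hLabel_add_colour_vLabel k) b b, halt.isVert_vLabel]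
  rfl

/-- The four ways to read a tile from one of its corners, with the vertical edge first. The corner
has the coordinate sum `k`, and the tile lies above or below, and right or left of it. -/
theorem swapSystem_sq_tile (hprime : D.Prime) (hred : D.Reduced) (halt : D.Alternating) (k : ℤ)
    {b : Bool} (hb : b = decide (Even k)) :
    (swapSystem hprime hred halt).sq (D.vLabel k, b) (D.hLabel (k + 1), !b) (D.hLabel k, b)
        (D.vLabel (k + 1), !b) ∧
      (swapSystem hprime hred halt).sq (D.vLabel k, b) (D.hLabel k, !b) (D.hLabel (k - 1), b)
        (D.vLabel (k - 1), !b) ∧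
      (swapSystem hprime hred halt).sq (D.vLabel (k - 1), b) (D.hLabel (k - 1), !b) (D.hLabel k, b)
        (D.vLabel k, !b) ∧
      (swapSystem hprime hred halt).sq (D.vLabel (k - 1), b) (D.hLabel (k - 1 - 1), !b)
        (D.hLabel (k - 1), b) (D.vLabel (k - 1 - 1), !b) := by
  have h : ∀ k : ℤ, ∀ b : Bool, b = decide (Even k) →
      (swapSystem hprime hred halt).sq (D.vLabel k, b) (D.hLabel (k + 1), !b) (D.hLabel k, b)
        (D.vLabel (k + 1), !b) := by
    rintro k _ rfl
    refine ⟨halt.isVert_vLabel k _, ?_⟩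
    by_cases hk : Even k
    · simpa [hk] using IsLetterSquare.source (halt.isRelatorSquare_of_even hk).reverse
    · simpa [hk] using IsLetterSquare.sink (halt.isRelatorSquare_of_odd hk).exchange
  have h₁ : (!b) = decide (Even (k - 1)) := by
    rw [hb, ← sub_add_cancel k 1, decide_even_add_one, Bool.not_not, sub_add_cancel]
  have h₂ : b = decide (Even (k - 1 - 1)) := by
    rw [← Bool.not_not b, h₁, ← sub_add_cancel (k - 1) 1, decide_even_add_one, Bool.not_not,
      sub_add_cancel]
  have h₃ := h _ _ h₁
  have h₄ := SwapSystem.sq_rotate_right _ (SwapSystem.sq_rotate_left _ (h _ _ h₂))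
  simp only [sub_add_cancel, swapSystem, Bool.not_not] at h₃ h₄ ⊢
  refine ⟨h k b hb, ?_, ?_, h₄⟩
  · simpa [swapSystem] using SwapSystem.sq_rotate_right (swapSystem hprime hred halt) h₃
  · simpa [swapSystem] using SwapSystem.sq_rotate_left (swapSystem hprime hred halt) h₃

theorem FlatEdge.symm {p q : ℤ × ℤ} {a : D.Region × Bool} (h : D.FlatEdge p a q) :
    D.FlatEdge q (a.1, !a.2) p := by
  cases h with
  | right x y => exact .left x y
  | left x y => simpa using FlatEdge.right x y
  | up x y => exact .down x y
  | down x y => simpa using FlatEdge.up x y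

theorem FlatEdge.cases_vert (halt : D.Alternating) {p q : ℤ × ℤ} {a : D.Region × Bool}
    (h : D.FlatEdge p a q) (ha : D.isVert a = true) :
    (a = (D.vLabel (p.1 + p.2), decide (Even (p.1 + p.2))) ∧ q = (p.1, p.2 + 1)) ∨
    (a = (D.vLabel (p.1 + p.2 - 1), decide (Even (p.1 + p.2))) ∧ q = (p.1, p.2 - 1)) := by
  cases h with
  | right x y => simp [halt.isVert_hLabel] at ha
  | left x y => simp [halt.isVert_hLabel] at ha
  | up x y => exact .inl ⟨rfl, rfl⟩
  | down x y =>
    refine .inr ⟨?_, by simp⟩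
    rw [← add_assoc, add_sub_cancel_right, decide_even_add_one]

theorem FlatEdge.cases_horiz (halt : D.Alternating) {p q : ℤ × ℤ} {a : D.Region × Bool}
    (h : D.FlatEdge p a q) (ha : D.isVert a = false) :
    (a = (D.hLabel (p.1 + p.2), decide (Even (p.1 + p.2))) ∧ q = (p.1 + 1, p.2)) ∨
    (a = (D.hLabel (p.1 + p.2 - 1), decide (Even (p.1 + p.2))) ∧ q = (p.1 - 1, p.2)) := by
  cases h with
  | right x y => exact .inl ⟨rfl, rfl⟩
  | left x y =>
    refine .inr ⟨?_, by simp⟩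
    rw [add_right_comm, add_sub_cancel_right, decide_even_add_one]
  | up x y => simp [halt.isVert_vLabel] at ha
  | down x y => simp [halt.isVert_vLabel] at ha

theorem FlatEdge.unique (hred : D.Reduced) (halt : D.Alternating) {p q q' : ℤ × ℤ}
    {a : D.Region × Bool} (h : D.FlatEdge p a q) (h' : D.FlatEdge p a q') : q = q' := by
  have h₀ := hred.hLabel_ne_hLabel (p.1 + p.2 - 1)
  rw [sub_add_cancel] at h₀
  rcases ha : D.isVert a with _ | _
  · rcases h.cases_horiz halt ha with ⟨h₁, rfl⟩ | ⟨h₁, rfl⟩ <;>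
      rcases h'.cases_horiz halt ha with ⟨h₂, rfl⟩ | ⟨h₂, rfl⟩ <;>
      first | rfl | (have := congrArg Prod.fst (h₁.symm.trans h₂); simp_all)
  · rcases h.cases_vert halt ha with ⟨h₁, rfl⟩ | ⟨h₁, rfl⟩ <;>
      rcases h'.cases_vert halt ha with ⟨h₂, rfl⟩ | ⟨h₂, rfl⟩ <;>
      first | rfl | (have := congrArg Prod.fst (h₁.symm.trans h₂); simp_all)

/-- The four edges that leave a vertex of the plane. -/
theorem flatEdge_of_eq {x y k : ℤ} {b : Bool} (hk : k = x + y) (hb : b = decide (Even k)) :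
    D.FlatEdge (x, y) (D.hLabel k, b) (x + 1, y) ∧
      D.FlatEdge (x, y) (D.hLabel (k - 1), b) (x - 1, y) ∧
      D.FlatEdge (x, y) (D.vLabel k, b) (x, y + 1) ∧
      D.FlatEdge (x, y) (D.vLabel (k - 1), b) (x, y - 1) := by
  have h₁ : b = !decide (Even (k - 1)) := by
    rw [hb, ← decide_even_add_one, sub_add_cancel]
  subst hk
  have h₂ := FlatEdge.left (D := D) (x - 1) y
  have h₃ := FlatEdge.down (D := D) x (y - 1)
  rw [sub_add_cancel, sub_add_eq_add_sub, ← h₁] at h₂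
  rw [sub_add_cancel, ← add_sub_assoc, ← h₁] at h₃
  rw [hb] at h₂ h₃ ⊢
  exact ⟨.right x y, h₂, .up x y, h₃⟩

/-- Two consecutive edges of the plane that span a relator square are a vertical and a horizontal
edge. They span a tile of the plane too, and since the relator square is unique, it is this tile. -/
theorem isLocallyConvex_flatEdge (hprime : D.Prime) (hred : D.Reduced) (halt : D.Alternating) :
    SwapSystem.IsLocallyConvex (swapSystem hprime hred halt) D.FlatEdge where
  symm h := h.symm
  unique h h' := h.unique hred halt h'
  sq := by
    rintro t x x' t' ⟨u, v⟩ q r h hp hq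
    obtain ⟨ht, hx, -, -⟩ := (swapSystem hprime hred halt).vert_of_sq h
    obtain ⟨b, hb⟩ : ∃ b, b = decide (Even (u + v)) := ⟨_, rfl⟩
    have hb' : (!b) = decide (Even (u + v + 1)) := by rw [decide_even_add_one, hb]
    have hb'' : (!b) = decide (Even (u + v - 1)) := by
      rw [hb, ← sub_add_cancel (u + v) 1, decide_even_add_one, Bool.not_not, sub_add_cancel]
    obtain ⟨h₁, h₂, h₃, h₄⟩ := swapSystem_sq_tile hprime hred halt (u + v) hb
    rcases hp.cases_vert halt ht with ⟨rfl, rfl⟩ | ⟨rfl, rfl⟩ <;>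
      rcases hq.cases_horiz halt hx with ⟨rfl, rfl⟩ | ⟨rfl, rfl⟩ <;>
      simp only [← add_assoc, ← add_sub_assoc, add_sub_cancel_right, ← hb, ← hb', ← hb''] at h ⊢
    · obtain ⟨rfl, rfl⟩ := SwapSystem.sq_unique _ h h₁
      exact ⟨_, (flatEdge_of_eq rfl hb).1, (flatEdge_of_eq (by ring) hb').2.2.1⟩
    · obtain ⟨rfl, rfl⟩ := SwapSystem.sq_unique _ h h₂
      exact ⟨_, (flatEdge_of_eq rfl hb).2.1, (flatEdge_of_eq (by ring) hb'').2.2.1⟩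
    · obtain ⟨rfl, rfl⟩ := SwapSystem.sq_unique _ h h₃
      have := (flatEdge_of_eq (D := D) (x := u + 1) (y := v) (by ring) hb').2.2.2
      rw [add_sub_cancel_right] at this
      exact ⟨_, (flatEdge_of_eq rfl hb).1, this⟩
    · obtain ⟨rfl, rfl⟩ := SwapSystem.sq_unique _ h h₄
      exact ⟨_, (flatEdge_of_eq rfl hb).2.1, (flatEdge_of_eq (by ring) hb'').2.2.2⟩
  sq' := by
    rintro t x x' t' ⟨u, v⟩ q r h hp hq
    obtain ⟨-, -, hx', ht'⟩ := (swapSystem hprime hred halt).vert_of_sq h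
    obtain ⟨b, hb⟩ : ∃ b, b = decide (Even (u + v)) := ⟨_, rfl⟩
    have hb' : (!b) = decide (Even (u + v + 1)) := by rw [decide_even_add_one, hb]
    have hb'' : (!b) = decide (Even (u + v - 1)) := by
      rw [hb, ← sub_add_cancel (u + v) 1, decide_even_add_one, Bool.not_not, sub_add_cancel]
    obtain ⟨h₁, h₂, h₃, h₄⟩ := swapSystem_sq_tile hprime hred halt (u + v) hb
    rcases hp.cases_horiz halt hx' with ⟨rfl, rfl⟩ | ⟨rfl, rfl⟩ <;>
      rcases hq.cases_vert halt ht' with ⟨rfl, rfl⟩ | ⟨rfl, rfl⟩ <;>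
      simp only [add_right_comm u 1 v, sub_add_eq_add_sub, add_sub_cancel_right, ← hb, ← hb',
        ← hb''] at h ⊢
    · obtain ⟨rfl, rfl⟩ := SwapSystem.sq_unique' h h₁
      exact ⟨_, (flatEdge_of_eq rfl hb).2.2.1, (flatEdge_of_eq (by ring) hb').1⟩
    · obtain ⟨rfl, rfl⟩ := SwapSystem.sq_unique' h h₃
      exact ⟨_, (flatEdge_of_eq rfl hb).2.2.2, (flatEdge_of_eq (by ring) hb'').1⟩
    · obtain ⟨rfl, rfl⟩ := SwapSystem.sq_unique' h h₂
      have := (flatEdge_of_eq (D := D) (x := u) (y := v + 1) (by ring) hb').2.1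
      rw [add_sub_cancel_right] at this
      exact ⟨_, (flatEdge_of_eq rfl hb).2.2.1, this⟩
    · obtain ⟨rfl, rfl⟩ := SwapSystem.sq_unique' h h₄
      exact ⟨_, (flatEdge_of_eq rfl hb).2.2.2, (flatEdge_of_eq (by ring) hb'').2.1⟩

end KnotDiagram

namespace KnotDiagram

variable {n : ℕ} {D : KnotDiagram n}

/-! ### The rewriting system decides the word problem of the augmented group -/

theorem eval_append (u v : D.Word) : D.eval (u ++ v) = D.eval u * D.eval v := by
  rw [eval, ← FreeGroup.mul_mk, map_mul]
  rfl

theorem eval_nil : D.eval [] = 1 := map_one _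

theorem eval_cons (a : D.Region × Bool) (w : D.Word) : D.eval (a :: w) = D.eval [a] * D.eval w :=
  eval_append [a] w

theorem eval_pos (r : D.Region) : D.eval [(r, true)] = PresentedGroup.of r := rfl

theorem eval_neg (r : D.Region) : D.eval [(r, false)] = (PresentedGroup.of r)⁻¹ := by
  rw [← eval_pos, eval, eval, ← map_inv, FreeGroup.inv_mk]
  rfl

theorem eval_inv (a : D.Region × Bool) : D.eval [a] * D.eval [(a.1, !a.2)] = 1 := by
  obtain ⟨r, _ | _⟩ := a <;> simp [eval_pos, eval_neg]

theorem IsRelatorSquare.of_mul_inv {p q r s : D.Region} (h : D.IsRelatorSquare p q r s) :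
    (PresentedGroup.of p : D.AugmentedGroup) * (PresentedGroup.of q)⁻¹ =
      PresentedGroup.of s * (PresentedGroup.of r)⁻¹ := by
  obtain ⟨i, σ, hi, h⟩ := h
  have h₀ : PresentedGroup.mk D.relators (D.relator i) = 1 :=
    PresentedGroup.one_of_mem ⟨i, hi, rfl⟩
  have h₁ : (D.gen i .left) * (D.gen (i + 1) .left)⁻¹ * (D.gen (i + 1) .right) *
      (D.gen i .right)⁻¹ = 1 := by
    simp only [relator, map_mul, map_inv] at h₀
    exact h₀
  have h₂ : (D.gen i .left) * (D.gen (i + 1) .left)⁻¹ =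
      D.gen i .right * (D.gen (i + 1) .right)⁻¹ := by
    rw [mul_assoc, mul_eq_one_iff_eq_inv, mul_inv_rev, inv_inv] at h₁
    exact h₁
  have h₃ : (D.gen (i + 1) .left) * (D.gen i .left)⁻¹ =
      D.gen (i + 1) .right * (D.gen i .right)⁻¹ := by
    simpa using congrArg (·⁻¹) h₂
  rcases h with ⟨rfl, rfl, rfl, rfl⟩ | ⟨rfl, rfl, rfl, rfl⟩ <;> cases σ
  exacts [h₂, h₂.symm, h₃, h₃.symm]

theorem IsLetterSquare.eval_eq {t x x' t' : D.Region × Bool} (h : D.IsLetterSquare t x x' t') :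
    D.eval [t, x] = D.eval [x', t'] := by
  cases h with
  | source h =>
    rw [eval_cons, eval_cons _ [_], eval_pos, eval_pos, eval_neg, eval_neg]
    exact h.of_mul_inv
  | sink h =>
    rw [eval_cons, eval_cons _ [_], eval_pos, eval_pos, eval_neg, eval_neg]
    have := h.of_mul_inv
    rw [mul_inv_eq_iff_eq_mul] at this
    rw [this]
    group

theorem eval_eq_of_step {hprime : D.Prime} {hred : D.Reduced} {halt : D.Alternating} {u v : D.Word}
    (h : (swapSystem hprime hred halt).Step u v) : D.eval u = D.eval v := by
  induction h with
  | cancel a l =>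
    rw [eval_cons, eval_cons _ l, ← mul_assoc]
    exact (congrArg (· * D.eval l) (eval_inv a)).trans (one_mul _)
  | @swap t x x' t' h l =>
    have := congrArg (· * D.eval l) h.2.eval_eq
    simpa only [← eval_append, List.cons_append, List.nil_append] using this
  | cons a h ih => rw [eval_cons, ih, ← eval_cons]

theorem eval_eq_of_steps {hprime : D.Prime} {hred : D.Reduced} {halt : D.Alternating}
    {u v : D.Word} (h : (swapSystem hprime hred halt).Steps u v) : D.eval u = D.eval v := by
  induction h with
  | refl => rfl
  | tail _ h ih => exact ih.trans (eval_eq_of_step h)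

/-- A generator as a unit of the monoid of words modulo rewriting. -/
def joinUnit (S : SwapSystem (D.Region × Bool)) (hS : ∀ a, S.inv a = (a.1, !a.2)) (r : D.Region) :
    S.joinCon.Quotientˣ where
  val := (FreeMonoid.ofList [(r, true)] : S.joinCon.Quotient)
  inv := (FreeMonoid.ofList [(r, false)] : S.joinCon.Quotient)
  val_inv := S.joinCon.eq.2 ⟨[], .single (by
    have := SwapSystem.Step.cancel (S := S) (r, true) []
    rwa [hS] at this), .refl⟩
  inv_val := S.joinCon.eq.2 ⟨[], .single (by
    have := SwapSystem.Step.cancel (S := S) (r, false) []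
    rwa [hS] at this), .refl⟩

/-- Each relator reduces to the empty word. The first swap depends on the colour of the first
letter. -/
theorem steps_relator (hprime : D.Prime) (hred : D.Reduced) (halt : D.Alternating)
    {p q r s : D.Region} (h : D.IsRelatorSquare p q r s) :
    (swapSystem hprime hred halt).Steps [(p, true), (q, false), (r, true), (s, false)] [] := by
  have hc : ∀ a l, (swapSystem hprime hred halt).Step (a :: (a.1, !a.2) :: l) l := fun a l =>
    .cancel a l
  rcases hp : D.isVert (p, true) with _ | _
  · have hq := D.isVert_of_add h.colour.2.2 true false
    rw [hp] at hq
    have hsq : (swapSystem hprime hred halt).sq (q, false) (r, true) (p, false) (s, true) :=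
      ⟨by simpa using hq.symm, .sink h⟩
    exact .head (.cons _ (.swap hsq _)) (.head (hc (p, true) _) (.single (hc (s, true) _)))
  · have hsq : (swapSystem hprime hred halt).sq (p, true) (q, false) (s, true) (r, false) :=
      ⟨hp, .source h⟩
    exact .head (.swap hsq _) (.head (.cons _ (hc (r, false) _)) (.single (hc (s, true) _)))

/-- Words that represent the same element have a common descendant. -/
theorem join_of_eval_eq (hprime : D.Prime) (hred : D.Reduced) (halt : D.Alternating) {u v : D.Word}
    (h : D.eval u = D.eval v) : Join (swapSystem hprime hred halt).Steps u v := by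
  set S := swapSystem hprime hred halt with hS
  have hinv : ∀ a, S.inv a = (a.1, !a.2) := fun _ => rfl
  have hrel : ∀ r ∈ D.relators, FreeGroup.lift (joinUnit S hinv) r = 1 := by
    rintro _ ⟨i, hi, rfl⟩
    refine Units.ext (S.joinCon.eq.2 ⟨[], ?_, .refl⟩)
    exact steps_relator hprime hred halt ⟨i, .left, hi, .inl ⟨rfl, rfl, rfl, rfl⟩⟩
  have key : ∀ w : D.Word, ((PresentedGroup.toGroup hrel (D.eval w) : S.joinCon.Quotientˣ) :
      S.joinCon.Quotient) = (FreeMonoid.ofList w : S.joinCon.Quotient) := by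
    intro w
    induction w with
    | nil => rw [eval_nil, map_one]; rfl
    | cons a w ih =>
      rw [eval_cons a w, map_mul, Units.val_mul, ih, ← List.singleton_append (l := w),
        FreeMonoid.ofList_append, Con.coe_mul]
      congr 1
      obtain ⟨r, _ | _⟩ := a
      · rw [eval_neg, map_inv, PresentedGroup.toGroup.of]; rfl
      · rw [eval_pos, PresentedGroup.toGroup.of]; rfl
  exact S.joinCon.eq.1 ((key u).symm.trans ((congrArg (fun g => ((PresentedGroup.toGroup hrel g :
    S.joinCon.Quotientˣ) : S.joinCon.Quotient)) h).trans (key v)))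

/-! ### The elements read in the flat plane -/

/-- Partial products of a family in a group, indexed by the integers. -/
theorem _root_.exists_int_prod {G : Type*} [Group G] (h : ℤ → G) :
    ∃ H : ℤ → G, H 0 = 1 ∧ ∀ k, H (k + 1) = H k * h k := by
  let f : ℕ → G := fun m => Nat.rec 1 (fun j g => g * h j) m
  let g : ℕ → G := fun m => Nat.rec 1 (fun j g => g * (h (-j - 1))⁻¹) m
  refine ⟨fun k => if 0 ≤ k then f k.toNat else g (-k).toNat, rfl, fun k => ?_⟩
  dsimp only
  rcases lt_or_ge k 0 with hk | hk
  · obtain ⟨m, rfl⟩ : ∃ m : ℕ, k = -m - 1 := ⟨(-k - 1).toNat, by omega⟩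
    have h₁ : (-(-(m : ℤ) - 1)).toNat = m + 1 := by omega
    have h₂ : (-(-(m : ℤ) - 1 + 1)).toNat = m := by omega
    rw [if_neg (show ¬ (0 : ℤ) ≤ -m - 1 by omega), h₁]
    have h₃ : g (m + 1) * h (-m - 1) = g m := inv_mul_cancel_right _ _
    rw [h₃]
    split_ifs with h₄
    · obtain rfl : m = 0 := by omega
      rfl
    · rw [h₂]
  · obtain ⟨m, rfl⟩ := Int.eq_ofNat_of_zero_le hk
    rw [if_pos (by omega), if_pos hk]
    have h₁ : ((m : ℤ) + 1).toNat = m + 1 := by omega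
    rw [h₁, Int.toNat_natCast]

theorem regionAt_periodic (k : ℤ) (s : Side) :
    D.regionAt (D.firstUnder + ((k + 2 * n : ℤ) : ZMod (2 * n))) s =
      D.regionAt (D.firstUnder + k) s := by
  have h : ((2 * n : ℕ) : ZMod (2 * n)) = 0 := ZMod.natCast_self _
  push_cast at h
  simp [h]

theorem sideAt_periodic (s : Side) (k : ℤ) : sideAt s (k + 2 * n) = sideAt s k := by
  simp [sideAt, Int.even_add]

theorem hLabel_periodic (k : ℤ) : D.hLabel (k + 2 * n) = D.hLabel k := by
  rw [hLabel, sideAt_periodic, regionAt_periodic, hLabel]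

theorem vLabel_periodic (k : ℤ) : D.vLabel (k + 2 * n) = D.vLabel k := by
  rw [vLabel, add_right_comm, sideAt_periodic, regionAt_periodic, vLabel]

variable (D)

/-- The element read along a horizontal edge of the flat plane from left to right. -/
def hElt (k : ℤ) : D.AugmentedGroup := D.eval [(D.hLabel k, decide (Even k))]

/-- The element read along a vertical edge of the flat plane upwards. -/
def vElt (k : ℤ) : D.AugmentedGroup := D.eval [(D.vLabel k, decide (Even k))]

variable {D}

theorem hElt_periodic (k : ℤ) : D.hElt (k + 2 * n) = D.hElt k := by
  simp [hElt, hLabel_periodic, Int.even_add]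

theorem vElt_periodic (k : ℤ) : D.vElt (k + 2 * n) = D.vElt k := by
  simp [vElt, vLabel_periodic, Int.even_add]

theorem vElt_mul_hElt (hprime : D.Prime) (hred : D.Reduced) (halt : D.Alternating) (k : ℤ) :
    D.vElt k * D.hElt (k + 1) = D.hElt k * D.vElt (k + 1) := by
  have h := (swapSystem_sq_tile hprime hred halt k rfl).1.2.eval_eq
  rw [← decide_even_add_one] at h
  rwa [eval_cons, eval_cons _ [_]] at h

/-- If the first passage is over, the meridian is read at the edge behind it instead, and a relator
identifies the two meridians. -/
theorem meridian_eq : D.meridian * D.hElt 0 = D.vElt 0 := by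
  have h : D.hElt 0 = D.gen D.firstUnder .left ∧ D.vElt 0 = D.gen D.firstUnder .right := by
    simp [hElt, vElt, eval_pos, hLabel, vLabel, sideAt, gen, Side.flip]
  rw [h.1, h.2, ← eq_mul_inv_iff_mul_eq, meridian, firstUnder]
  split_ifs with h₀
  · have h₁ : D.IsRelatorSquare (D.regionAt 0 .right) (D.regionAt 0 .left)
        (D.regionAt (0 + 1) .left) (D.regionAt (0 + 1) .right) :=
      isRelatorSquare_iff_over.2 ⟨0, .right, h₀, .inl ⟨rfl, rfl, rfl, rfl⟩⟩
    have h₂ := h₁.of_mul_inv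
    rw [zero_add] at h₂
    exact h₂
  · rfl

theorem hElt_mul_vElt (j : ℕ) : D.hElt (2 * j) * D.vElt (2 * j + 1) =
    D.gen (D.firstUnder + 2 * j) .left * (D.gen (D.firstUnder + 2 * j + 1) .left)⁻¹ := by
  have h₁ : ¬ Even (2 * (j : ℤ) + 1) := by simp
  simp [hElt, vElt, eval_pos, eval_neg, hLabel, vLabel, sideAt, gen, h₁, add_assoc]

/-- Exactly one of the passages `2 j` and `2 j + 1` is under, and its contribution to the longitude
is read along two consecutive edges of a staircase in the flat plane. -/
theorem longitude_factor (halt : D.Alternating) (j : ℕ) :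
    (if D.isOver (2 * j : ℕ) then 1
        else D.gen (2 * j : ℕ) .left * (D.gen ((2 * j : ℕ) + 1) .left)⁻¹) *
      (if D.isOver (2 * j + 1 : ℕ) then 1
        else D.gen (2 * j + 1 : ℕ) .left * (D.gen ((2 * j + 1 : ℕ) + 1) .left)⁻¹) =
    D.hElt (2 * j) * D.vElt (2 * j + 1) := by
  have h₁ := halt.isOver_firstUnder_add (2 * j)
  have h₂ := halt (2 * j : ℕ)
  rw [hElt_mul_vElt]
  rcases h₀ : D.isOver 0 with _ | _
  · have hf : D.firstUnder = 0 := by simp [firstUnder, h₀]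
    rw [hf] at h₁ ⊢
    simp only [even_two, Even.mul_right, decide_true, Bool.not_true, zero_add] at h₁ ⊢
    push_cast at h₁ h₂ ⊢
    simp [h₁, h₂]
  · have hf : D.firstUnder = 1 := by simp [firstUnder, h₀]
    rw [hf] at h₁ ⊢
    simp only [even_two, Even.mul_right, decide_true, Bool.not_true] at h₁ ⊢
    push_cast at h₁ h₂ ⊢
    rw [add_comm] at h₁
    rw [h₁] at h₂
    have h₃ : D.isOver (2 * j) = true := by simpa using h₂.symm
    simp [h₁, h₃, add_comm (1 : ZMod (2 * n))]

/-- The element read along the paths of the flat plane that start at the origin. Going along the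
bottom row to the diagonal of an end point, and then along this diagonal, where one reads a
conjugate of the meridian in each step, one finds that it is `μ ^ y` times a partial product of
the bottom row. -/
theorem exists_potential (hprime : D.Prime) (hred : D.Reduced) (halt : D.Alternating) :
    ∃ φ : ℤ × ℤ → D.AugmentedGroup, (∀ p a q, D.FlatEdge p a q → φ q = φ p * D.eval [a]) ∧
      ∀ a b : ℤ, φ (a * n - b, a * n + b) = D.longitude ^ a * D.meridian ^ b := by
  obtain ⟨H, hH₀, hH⟩ := exists_int_prod D.hElt
  have hμ : ∀ k, D.meridian * H k * D.hElt k = H k * D.vElt k := by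
    have hstep : ∀ k, D.meridian * H (k + 1) * D.hElt (k + 1) = H (k + 1) * D.vElt (k + 1) ↔
        D.meridian * H k * D.hElt k = H k * D.vElt k := by
      intro k
      rw [hH, mul_assoc (H k), ← vElt_mul_hElt hprime hred halt, ← mul_assoc, ← mul_assoc,
        mul_left_inj]
    intro k
    induction k with
    | zero => simpa [hH₀] using meridian_eq
    | succ k ih => exact (hstep _).2 ih
    | pred k ih => exact (hstep _).1 (by rwa [sub_add_cancel])
  have hper : ∀ k, H (k + 2 * n) = H (2 * n) * H k := by
    have hstep : ∀ k, H (k + 1 + 2 * n) = H (2 * n) * H (k + 1) ↔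
        H (k + 2 * n) = H (2 * n) * H k := by
      intro k
      rw [add_right_comm, hH, hH, hElt_periodic, ← mul_assoc, mul_left_inj]
    intro k
    induction k with
    | zero => simp [hH₀]
    | succ k ih => exact (hstep _).2 ih
    | pred k ih => exact (hstep _).1 (by rwa [sub_add_cancel])
  have hpow : ∀ a : ℤ, H (a * (2 * n)) = H (2 * n) ^ a := by
    have hstep : ∀ a : ℤ, H ((a + 1) * (2 * n)) = H (2 * n) ^ (a + 1) ↔
        H (a * (2 * n)) = H (2 * n) ^ a := by
      intro a
      rw [add_mul, one_mul, hper, add_comm a 1, zpow_one_add, mul_right_inj]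
    intro a
    induction a with
    | zero => simp [hH₀]
    | succ k ih => exact (hstep _).2 ih
    | pred k ih => exact (hstep _).1 (by rwa [sub_add_cancel])
  have hcomm : Commute D.meridian (H (2 * n)) := by
    have h₁ := hμ (2 * n)
    have h₂ := hElt_periodic (D := D) 0
    have h₃ := vElt_periodic (D := D) 0
    rw [zero_add] at h₂ h₃
    rw [h₂, h₃, ← meridian_eq, ← mul_assoc] at h₁
    exact mul_right_cancel h₁
  have hup : ∀ (y k : ℤ), D.meridian ^ (y + 1) * H (k + 1) = D.meridian ^ y * H k * D.vElt k := by
    intro y k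
    rw [hH, zpow_add_one, mul_assoc (_ ^ y) (H k), ← hμ]
    simp only [mul_assoc]
  have hlong : ∀ m : ℕ, ((List.range (2 * m)).map fun k : ℕ =>
      if D.isOver k then 1 else D.gen k .left * (D.gen (k + 1) .left)⁻¹).prod =
        D.meridian ^ (m : ℤ) * H (2 * m) := by
    intro m
    induction m with
    | zero => simp [hH₀]
    | succ m ih =>
      rw [Nat.mul_succ, List.range_succ, List.range_succ, List.map_append, List.map_append,
        List.prod_append, List.prod_append, ih]
      simp only [List.map_cons, List.map_nil, List.prod_cons, List.prod_nil, mul_one]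
      rw [mul_assoc, longitude_factor halt, ← mul_assoc, mul_assoc (_ ^ _), ← hH, ← hup]
      push_cast
      congr 2
  have hlong' : D.longitude = D.meridian ^ (n : ℤ) * H (2 * n) := hlong n
  have hE : ∀ x y : ℤ, D.meridian ^ y * H (x + 1 + y) =
      D.meridian ^ y * H (x + y) * D.hElt (x + y) := fun x y => by
    rw [add_right_comm, hH, mul_assoc]
  have hN : ∀ x y : ℤ, D.meridian ^ (y + 1) * H (x + (y + 1)) =
      D.meridian ^ y * H (x + y) * D.vElt (x + y) := fun x y => by
    rw [← add_assoc, hup]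
  refine ⟨fun p => D.meridian ^ p.2 * H (p.1 + p.2), ?_, fun a b => ?_⟩
  · rintro _ _ _ (⟨x, y⟩ | ⟨x, y⟩ | ⟨x, y⟩ | ⟨x, y⟩)
    · exact hE x y
    · simp only [hE, mul_assoc]
      rw [hElt, eval_inv, mul_one]
    · exact hN x y
    · simp only [hN, mul_assoc]
      rw [vElt, eval_inv, mul_one]
  · have h₁ : a * (n : ℤ) - b + (a * n + b) = a * (2 * n) := by ring
    have h₂ : Commute (D.meridian ^ (n : ℤ)) (H (2 * n)) := hcomm.zpow_left _
    simp only [h₁]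
    rw [hpow, hlong', h₂.mul_zpow, ← zpow_mul, mul_comm (n : ℤ) a, zpow_add, mul_assoc, mul_assoc]
    congr 1
    exact (hcomm.zpow_zpow _ _).eq

/-- Words that label paths of the flat plane from the origin represent `λ ^ a * μ ^ b` according to
the end point. -/
theorem eval_eq_of_labelsPath (hprime : D.Prime) (hred : D.Reduced) (halt : D.Alternating)
    {w : D.Word} {a b : ℤ}
    (h : SwapSystem.LabelsPath D.FlatEdge (0, 0) w (a * n - b, a * n + b)) :
    D.eval w = D.longitude ^ a * D.meridian ^ b := by
  obtain ⟨φ, hφ, hφ'⟩ := exists_potential hprime hred halt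
  have key : ∀ {p w q}, SwapSystem.LabelsPath D.FlatEdge p w q → φ q = φ p * D.eval w := by
    intro p w q h
    induction h with
    | nil p => rw [eval_nil, mul_one]
    | @cons _ _ _ a w h _ ih => rw [ih, hφ _ _ _ h, eval_cons a w, mul_assoc]
  have h₀ := hφ' 0 0
  simp only [zero_mul, sub_zero, add_zero, zpow_zero, mul_one] at h₀
  rw [← hφ', key h, h₀, one_mul]

end KnotDiagram

namespace KnotDiagram

variable {n : ℕ} {D : KnotDiagram n}

/-! ### Edge-paths of the peripheral complex -/

theorem grid_connected : grid.Connected :=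
  have h : (SimpleGraph.hasse ℤ).Connected := ⟨SimpleGraph.hasse_preconnected_of_succ ℤ⟩
  h.boxProd h

theorem grid_adj_iff {p q : ℤ × ℤ} : grid.Adj p q ↔
    q = (p.1 + 1, p.2) ∨ p = (q.1 + 1, q.2) ∨ q = (p.1, p.2 + 1) ∨ p = (q.1, q.2 + 1) := by
  obtain ⟨a, b⟩ := p
  obtain ⟨c, d⟩ := q
  simp only [SimpleGraph.boxProd_adj, SimpleGraph.hasse_adj, Order.covBy_iff_add_one_eq,
    Prod.mk.injEq]
  omega

variable (D)

/-- A step of an edge-path of the peripheral complex from `p` to `q`, with the letter `a`. -/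
def TileEdge (s : Side) (p : ℤ × ℤ) (a : D.Region × Bool) (q : ℤ × ℤ) : Prop :=
  ∃ h : grid.Adj p q, D.letter s ⟨(p, q), h⟩ = a

variable {D}

theorem tileEdge_iff {s : Side} {p q : ℤ × ℤ} {a : D.Region × Bool} : D.TileEdge s p a q ↔
    (q = (p.1 + 1, p.2) ∧ a = ((D.tile s p).bottom, decide (Even (p.1 + p.2)))) ∨
    (p = (q.1 + 1, q.2) ∧ a = ((D.tile s q).bottom, !decide (Even (q.1 + q.2)))) ∨
    (q = (p.1, p.2 + 1) ∧ a = ((D.tile s p).left, decide (Even (p.1 + p.2)))) ∨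
    (p = (q.1, q.2 + 1) ∧ a = ((D.tile s q).left, !decide (Even (q.1 + q.2)))) := by
  have h₁ : ∀ x y : ℤ, decide (Even (x + 1 + y)) = !decide (Even (x + y)) := fun x y => by
    rw [add_right_comm, decide_even_add_one]
  have h₂ : ∀ x y : ℤ, decide (Even (x + (y + 1))) = !decide (Even (x + y)) := fun x y => by
    rw [← add_assoc, decide_even_add_one]
  constructor
  · rintro ⟨h, rfl⟩
    obtain ⟨a, b⟩ := p
    obtain ⟨c, d⟩ := q
    rcases grid_adj_iff.1 h with h | h | h | h <;> obtain ⟨rfl, rfl⟩ := Prod.mk.inj h <;>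
      simp [letter, tile, h₁, h₂]
  · obtain ⟨x, y⟩ := p
    obtain ⟨x', y'⟩ := q
    rintro (⟨h, rfl⟩ | ⟨h, rfl⟩ | ⟨h, rfl⟩ | ⟨h, rfl⟩) <;> obtain ⟨rfl, rfl⟩ := Prod.mk.inj h
    · exact ⟨grid_adj_iff.2 (.inl rfl), by simp [letter, tile]⟩
    · exact ⟨grid_adj_iff.2 (.inr (.inl rfl)), by simp [letter, tile, h₁]⟩
    · exact ⟨grid_adj_iff.2 (.inr (.inr (.inl rfl))), by simp [letter, tile]⟩
    · exact ⟨grid_adj_iff.2 (.inr (.inr (.inr rfl))), by simp [letter, tile, h₂]⟩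

theorem tileEdge_left_iff {p q : ℤ × ℤ} {a : D.Region × Bool} :
    D.TileEdge .left p a q ↔ D.FlatEdge p a q := by
  have hv : ∀ p : ℤ × ℤ, (D.tile .left p).left = D.vLabel (p.1 + p.2) := fun p => by
    simp only [tile, square, vLabel, flip_sideAt]
  rw [tileEdge_iff]
  simp only [hv]
  constructor
  · obtain ⟨x, y⟩ := p
    obtain ⟨x', y'⟩ := q
    rintro (⟨h, rfl⟩ | ⟨h, rfl⟩ | ⟨h, rfl⟩ | ⟨h, rfl⟩) <;> obtain ⟨rfl, rfl⟩ := Prod.mk.inj h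
    exacts [.right _ _, .left _ _, .up _ _, .down _ _]
  · rintro (⟨x, y⟩ | ⟨x, y⟩ | ⟨x, y⟩ | ⟨x, y⟩)
    exacts [.inl ⟨rfl, rfl⟩, .inr (.inl ⟨rfl, rfl⟩), .inr (.inr (.inl ⟨rfl, rfl⟩)),
      .inr (.inr (.inr ⟨rfl, rfl⟩))]

/-- The two ways to place the first square give complexes that are reflections of each other. -/
theorem tileEdge_right_iff {p q : ℤ × ℤ} {a : D.Region × Bool} :
    D.TileEdge .right p a q ↔ D.TileEdge .left p.swap a q.swap := by
  have h₀ : ∀ k, sideAt .right k = (sideAt .left k).flip := fun k => by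
    unfold sideAt
    split_ifs <;> rfl
  have h₁ : ∀ p : ℤ × ℤ, (D.tile .right p).bottom = (D.tile .left p.swap).left := fun p => by
    simp only [tile, square, h₀, Prod.fst_swap, Prod.snd_swap, add_comm p.2]
  have h₂ : ∀ p : ℤ × ℤ, (D.tile .right p).left = (D.tile .left p.swap).bottom := fun p => by
    simp only [tile, square, h₀, Side.flip_flip, Prod.fst_swap, Prod.snd_swap, add_comm p.2]
  rw [tileEdge_iff, tileEdge_iff]
  simp only [h₁, h₂, Prod.fst_swap, Prod.snd_swap, add_comm p.2, add_comm q.2, Prod.ext_iff]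
  tauto

theorem labelsPath_pathLabel (s : Side) {u v : ℤ × ℤ} (p : grid.Walk u v) :
    SwapSystem.LabelsPath (D.TileEdge s) u (D.pathLabel s p) v := by
  induction p with
  | nil => exact .nil _
  | cons h p ih => exact .cons ⟨h, rfl⟩ ih

theorem exists_walk_of_labelsPath {s : Side} {u v : ℤ × ℤ} {w : D.Word}
    (h : SwapSystem.LabelsPath (D.TileEdge s) u w v) :
    ∃ p : grid.Walk u v, D.pathLabel s p = w := by
  induction h with
  | nil p => exact ⟨.nil, rfl⟩
  | cons h _ ih =>
    obtain ⟨h, rfl⟩ := h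
    obtain ⟨p, rfl⟩ := ih
    exact ⟨.cons h p, rfl⟩

theorem length_pathLabel (s : Side) {u v : ℤ × ℤ} (p : grid.Walk u v) :
    (D.pathLabel s p).length = p.length := by
  simp [pathLabel]

theorem labelsPath_right_iff {u v : ℤ × ℤ} {w : D.Word} :
    SwapSystem.LabelsPath (D.TileEdge .right) u w v ↔
      SwapSystem.LabelsPath D.FlatEdge u.swap w v.swap := by
  constructor
  · intro h
    induction h with
    | nil p => exact .nil _
    | cons h _ ih => exact .cons (tileEdge_left_iff.1 (tileEdge_right_iff.1 h)) ih
  · induction w generalizing u with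
    | nil =>
      intro h
      cases u; cases v
      cases h
      exact .nil _
    | cons a w ih =>
      rintro (_ | ⟨h, hw⟩)
      rename_i q
      have h' : D.TileEdge .right u a q.swap :=
        tileEdge_right_iff.2 (tileEdge_left_iff.2 (by rwa [Prod.swap_swap]))
      exact .cons h' (ih (by rwa [Prod.swap_swap]))

theorem labelsPath_left_iff {u v : ℤ × ℤ} {w : D.Word} :
    SwapSystem.LabelsPath (D.TileEdge .left) u w v ↔ SwapSystem.LabelsPath D.FlatEdge u w v := by
  have : D.TileEdge .left = D.FlatEdge := by
    ext p a q
    exact tileEdge_left_iff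
  rw [this]

/-- If all labels of paths from `u` to `v` represent the same element, then a geodesic word that
labels such a path labels a geodesic one. -/
theorem IsGeodesicWord.labelsGeodesicPath_iff {w : D.Word} (hw : D.IsGeodesicWord w) {s : Side}
    {u v : ℤ × ℤ} {g : D.AugmentedGroup}
    (hg : ∀ w', SwapSystem.LabelsPath (D.TileEdge s) u w' v → D.eval w' = g) :
    D.LabelsGeodesicPath s w u v ↔ SwapSystem.LabelsPath (D.TileEdge s) u w v := by
  constructor
  · rintro ⟨p, -, rfl⟩
    exact labelsPath_pathLabel s p
  · intro h
    obtain ⟨p, rfl⟩ := exists_walk_of_labelsPath h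
    obtain ⟨q, hq⟩ := p.reachable.exists_walk_length_eq_dist
    have hp : D.eval (D.pathLabel s q) = D.eval (D.pathLabel s p) :=
      (hg _ (labelsPath_pathLabel s q)).trans (hg _ h).symm
    have := hw _ hp
    rw [length_pathLabel, length_pathLabel, hq] at this
    exact ⟨p, le_antisymm this (SimpleGraph.dist_le p), rfl⟩

/-! ### Words that represent peripheral elements -/

theorem exists_labelsPath (u v : ℤ × ℤ) : ∃ w, SwapSystem.LabelsPath D.FlatEdge u w v := by
  obtain ⟨p⟩ := grid_connected.preconnected u v
  exact ⟨_, labelsPath_left_iff.1 (labelsPath_pathLabel (D := D) .left p)⟩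

/-- A word that labels a path to the end point of `λ ^ a * μ ^ b` and a word for this element have
a common descendant, and all descendants of the former label paths. -/
theorem exists_steps_labelsPath (hprime : D.Prime) (hred : D.Reduced) (halt : D.Alternating)
    {w : D.Word} {a b : ℤ} (h : D.eval w = D.longitude ^ a * D.meridian ^ b) :
    ∃ z, (swapSystem hprime hred halt).Steps w z ∧
      SwapSystem.LabelsPath D.FlatEdge (0, 0) z (a * n - b, a * n + b) := by
  obtain ⟨v, hv⟩ := exists_labelsPath (D := D) (0, 0) (a * n - b, a * n + b)
  obtain ⟨z, hz, hz'⟩ := join_of_eval_eq hprime hred halt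
    (h.trans (eval_eq_of_labelsPath hprime hred halt hv).symm)
  exact ⟨z, hz, (isLocallyConvex_flatEdge hprime hred halt).labelsPath_steps hz' hv⟩

/-- The reduction of a geodesic word consists of swaps only, and these do not leave the plane. -/
theorem IsGeodesicWord.eval_eq_iff (hprime : D.Prime) (hred : D.Reduced) (halt : D.Alternating)
    {w : D.Word} (hw : D.IsGeodesicWord w) (a b : ℤ) :
    D.eval w = D.longitude ^ a * D.meridian ^ b ↔
      SwapSystem.LabelsPath D.FlatEdge (0, 0) w (a * n - b, a * n + b) := by
  refine ⟨fun h => ?_, eval_eq_of_labelsPath hprime hred halt⟩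
  obtain ⟨z, hz, hz'⟩ := exists_steps_labelsPath hprime hred halt h
  have h₁ := hw z (eval_eq_of_steps hz).symm
  have h₂ := SwapSystem.Steps.length_le hz
  exact (isLocallyConvex_flatEdge hprime hred halt).labelsPath_of_steps hz (le_antisymm h₂ h₁) hz'

variable (D) in
/-- The labelled edges of the torus that is the quotient of the flat plane by the translations
through `(n, n)` and `(-1, 1)`: its vertices are the coordinate sums of the vertices of the plane
modulo `2 * n`, shifted by `D.firstUnder`, so that the labels of the edges between `k` and `k + 1`
are the regions beside the edge `k` of the knot. -/
def TorusEdge (i : ZMod (2 * n)) (a : D.Region × Bool) (j : ZMod (2 * n)) : Prop :=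
  a.2 = !D.isOver i ∧ ∃ s, (j = i + 1 ∧ a.1 = D.regionAt i s) ∨ (i = j + 1 ∧ a.1 = D.regionAt j s)

theorem regionAt_eq_or (k : ℤ) (s : Side) :
    D.regionAt (D.firstUnder + k) s = D.hLabel k ∨
      D.regionAt (D.firstUnder + k) s = D.vLabel k := by
  rw [hLabel, vLabel, ← flip_sideAt]
  generalize sideAt .left k = t
  cases s <;> cases t <;> simp [Side.flip]

theorem Alternating.torusEdge_of_flatEdge (halt : D.Alternating) {p q : ℤ × ℤ}
    {a : D.Region × Bool} (h : D.FlatEdge p a q) :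
    D.TorusEdge (D.firstUnder + (p.1 + p.2 : ℤ)) a (D.firstUnder + (q.1 + q.2 : ℤ)) := by
  refine ⟨?_, ?_⟩
  · rw [halt.isOver_firstUnder_add, Bool.not_not]
    rcases h with ⟨x, y⟩ | ⟨x, y⟩ | ⟨x, y⟩ | ⟨x, y⟩
    · rfl
    · rw [add_right_comm, decide_even_add_one]
    · rfl
    · rw [← add_assoc, decide_even_add_one]
  · rcases h with ⟨x, y⟩ | ⟨x, y⟩ | ⟨x, y⟩ | ⟨x, y⟩
    · exact ⟨_, .inl ⟨by push_cast; ring, rfl⟩⟩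
    · exact ⟨_, .inr ⟨by push_cast; ring, rfl⟩⟩
    · exact ⟨_, .inl ⟨by push_cast; ring, rfl⟩⟩
    · exact ⟨_, .inr ⟨by push_cast; ring, rfl⟩⟩

theorem Alternating.exists_flatEdge_of_torusEdge (halt : D.Alternating) {p : ℤ × ℤ}
    {a : D.Region × Bool} {j : ZMod (2 * n)}
    (h : D.TorusEdge (D.firstUnder + (p.1 + p.2 : ℤ)) a j) :
    ∃ q, D.FlatEdge p a q ∧ j = D.firstUnder + (q.1 + q.2 : ℤ) := by
  obtain ⟨r, b⟩ := a
  obtain ⟨x, y⟩ := p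
  obtain ⟨hb, s, h⟩ := h
  dsimp only at hb h
  rw [halt.isOver_firstUnder_add, Bool.not_not] at hb
  obtain ⟨h₁, h₂, h₃, h₄⟩ := flatEdge_of_eq (D := D) rfl hb
  rcases h with ⟨rfl, rfl⟩ | ⟨h, rfl⟩
  · rcases regionAt_eq_or (D := D) (x + y) s with h | h <;> rw [h]
    · exact ⟨_, h₁, by push_cast; ring⟩
    · exact ⟨_, h₃, by push_cast; ring⟩
  · obtain rfl : j = D.firstUnder + (x + y - 1 : ℤ) := by
      rw [← sub_eq_iff_eq_add] at h
      rw [← h]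
      push_cast
      ring
    rcases regionAt_eq_or (D := D) (x + y - 1) s with h | h <;> rw [h]
    · exact ⟨_, h₂, by push_cast; ring⟩
    · exact ⟨_, h₄, by push_cast; ring⟩

theorem Alternating.labelsPath_torusEdge (halt : D.Alternating) {p q : ℤ × ℤ} {w : D.Word}
    (h : SwapSystem.LabelsPath D.FlatEdge p w q) :
    SwapSystem.LabelsPath D.TorusEdge (D.firstUnder + (p.1 + p.2 : ℤ)) w
      (D.firstUnder + (q.1 + q.2 : ℤ)) := by
  induction h with
  | nil p => exact .nil _
  | cons h _ ih => exact .cons (halt.torusEdge_of_flatEdge h) ih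

theorem Alternating.exists_labelsPath_of_torusEdge (halt : D.Alternating) {p : ℤ × ℤ}
    {j : ZMod (2 * n)} {w : D.Word}
    (h : SwapSystem.LabelsPath D.TorusEdge (D.firstUnder + (p.1 + p.2 : ℤ)) w j) :
    ∃ q, SwapSystem.LabelsPath D.FlatEdge p w q ∧ j = D.firstUnder + (q.1 + q.2 : ℤ) := by
  induction w generalizing p with
  | nil => cases h; exact ⟨p, .nil p, rfl⟩
  | cons a w ih =>
    rcases h with _ | ⟨h, hw⟩
    obtain ⟨r, hr, rfl⟩ := halt.exists_flatEdge_of_torusEdge h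
    obtain ⟨q, hq, rfl⟩ := ih hw
    exact ⟨q, .cons hr hq, rfl⟩

/-- A word that cannot be rewritten represents a peripheral element iff it labels a loop on the
torus. -/
theorem isPeripheral_iff_of_irreducible (hprime : D.Prime) (hred : D.Reduced)
    (halt : D.Alternating) {z : D.Word} (hz : ∀ v, ¬ (swapSystem hprime hred halt).Step z v) :
    D.IsPeripheral (D.eval z) ↔
      SwapSystem.LabelsPath D.TorusEdge D.firstUnder z D.firstUnder := by
  constructor
  · rintro ⟨a, b, h⟩
    obtain ⟨z', hz', h⟩ := exists_steps_labelsPath hprime hred halt h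
    obtain rfl : z = z' := by
      rcases hz'.cases_head with h | ⟨v, hv, -⟩
      exacts [h, absurd hv (hz v)]
    have h₁ := halt.labelsPath_torusEdge h
    have h₂ : ((2 * n : ℕ) : ZMod (2 * n)) = 0 := ZMod.natCast_self _
    have h₃ : ((a * n - b + (a * n + b) : ℤ) : ZMod (2 * n)) = 0 := by
      have : (a * n - b + (a * n + b) : ℤ) = a * (2 * n : ℕ) := by push_cast; ring
      rw [this, Int.cast_mul, Int.cast_natCast, h₂, mul_zero]
    dsimp only at h₁
    rwa [h₃, add_zero, Int.cast_zero, add_zero] at h₁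
  · intro h
    obtain ⟨⟨x, y⟩, hq, h₁⟩ := halt.exists_labelsPath_of_torusEdge (p := (0, 0)) (by simpa using h)
    rw [left_eq_add, ZMod.intCast_zmod_eq_zero_iff_dvd] at h₁
    obtain ⟨a, ha⟩ := h₁
    push_cast at ha
    refine ⟨a, y - a * n, eval_eq_of_labelsPath hprime hred halt ?_⟩
    convert hq using 2
    · linear_combination -ha
    · ring

end KnotDiagram

namespace SwapSystem

/-! ### A multi-stack machine that reduces a word and reads the result -/

variable {α : Type*} {S : SwapSystem α}

theorem Step.inversions_le {u v : List α} (h : S.Step u v) :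
    S.inversions v ≤ S.inversions u := by
  induction h with
  | cancel a l => exact S.inversions_cancel a l
  | swap h l => exact (inversions_swap h l).symm ▸ Nat.le_succ _
  | cons a h ih =>
    have := h.countP_le
    simp only [inversions]
    split_ifs <;> omega

theorem inversions_append_swap {t x x' t' : α} (h : S.sq t x x' t') (u l : List α) :
    S.inversions (u ++ t :: x :: l) = S.inversions (u ++ x' :: t' :: l) + 1 := by
  obtain ⟨h₁, h₂, h₃, h₄⟩ := S.vert_of_sq h
  rw [inversions_append, inversions_append, inversions_swap h]
  simp only [List.countP_cons, h₁, h₂, h₃, h₄]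
  simp
  ring

variable (S) in
/-- Two consecutive letters `t x` that admit no rewriting step. The second letter comes first, as in
a stack. -/
def IsReducedPair (x t : α) : Prop := x ≠ S.inv t ∧ ∀ x' t', ¬ S.sq t x x' t'

/-- A word is irreducible if none of its pairs of consecutive letters can be rewritten. -/
theorem not_step_of_isChain {u v : List α} (h : u.IsChain fun t x => S.IsReducedPair x t) :
    ¬ S.Step u v := by
  intro hs
  induction hs with
  | cancel a l => exact (List.isChain_cons_cons.1 h).1.1 rfl
  | swap hq l => exact (List.isChain_cons_cons.1 h).1.2 _ _ hq
  | cons a _ ih => exact ih h.tail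

/-- The stacks of the machine. -/
inductive Stack : Type
  | input
  | store
  | output
  deriving DecidableEq

instance : Fintype Stack where
  elems := {.input, .store, .output}
  complete k := by cases k <;> simp

/-- The phases of the computation: the word is reduced, and then the result is read. -/
inductive Phase : Type
  | reduce
  | read

instance : Fintype Phase where
  elems := ⟨{.reduce, .read}, by simp⟩
  complete k := by cases k <;> simp

variable {α V : Type} (S : SwapSystem α) (E : V → α → V → Prop)

/-- The alphabets of the stacks. -/
abbrev StackAlphabet (α : Type) : Stack → Type
  | .input => α
  | .store => α
  | .output => Bool

/-- The contents of the stacks. -/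
def contents (R L : List α) (O : List Bool) : ∀ k, List (StackAlphabet α k)
  | .input => R
  | .store => L
  | .output => O

open Classical in
/-- The two letters `x' t'` that replace `t x` if these are the first half of a square. -/
noncomputable def rewritePair (t x : α) : Option (α × α) :=
  if h : ∃ y : α × α, S.sq t x y.1 y.2 then some h.choose else none

/-- The vertices from which an edge with label `a` leads to a vertex in `A`. -/
def predecessors (a : α) (A : Set V) : Set V := {i | ∃ j ∈ A, E i a j}

/-- The registers of the machine: the current letter, the letter in front of it, and the set of the
vertices from which the letters that have been read lead to the end point. -/
abbrev Registers (α V : Type) : Type := Option α × Option α × Set V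

open Turing.TM2 Turing.TM2.Stmt

open Classical in
/-- The program of the machine. The store holds a reduced word, with its last letter on the top, and
the input holds the rest of the word. In the first phase the first letter of the input is cancelled
against the top of the store, or both are replaced by their swap, which goes to the input, or the
letter is moved to the store. In the second phase, the store is read, that is, the edges of a
labelled graph with the labels in the store are followed backwards. -/
noncomputable def program [Inhabited α] (p q : V) :
    Phase → Turing.TM2.Stmt (StackAlphabet α) Phase (Registers α V)
  | .reduce =>
    pop .input (fun v x => (x, none, v.2.2)) <|
    branch (fun v => v.1.isNone) (goto fun _ => .read) <|
    pop .store (fun v t => (v.1, t, v.2.2)) <|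
    branch (fun v => decide (v.1 = v.2.1.map S.inv)) (goto fun _ => .reduce) <|
    branch (fun v => ((v.2.1.bind fun t => v.1.bind fun x => S.rewritePair t x)).isSome)
      (push .input (fun v =>
        ((v.2.1.bind fun t => v.1.bind fun x => S.rewritePair t x).getD default).2) <|
      push .input (fun v =>
        ((v.2.1.bind fun t => v.1.bind fun x => S.rewritePair t x).getD default).1) <|
      goto fun _ => .reduce) <|
    branch (fun v => v.2.1.isSome)
      (push .store (fun v => v.2.1.getD default) <|
      push .store (fun v => v.1.getD default) <|
      goto fun _ => .reduce)
      (push .store (fun v => v.1.getD default) <|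
      goto fun _ => .reduce)
  | .read =>
    pop .store (fun v a => (a, none, a.elim v.2.2 fun a => predecessors E a v.2.2)) <|
    branch (fun v => v.1.isSome) (goto fun _ => .read) <|
    push .output (fun v => decide (p ∈ v.2.2)) <|
    load (fun _ => (none, none, {q})) halt

/-- The machine that reduces a word and decides whether the result labels a path from `p` to `q`. -/
noncomputable def machine [Fintype α] [Inhabited α] [Finite V] (p q : V) : Turing.FinTM2 where
  K := Stack
  k₀ := .input
  k₁ := .output
  Γ := StackAlphabet α
  Λ := Phase
  main := .reduce
  σ := Registers α V
  initialState := (none, none, {q})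
  σFin := Fintype.ofFinite _
  Γk₀Fin := inferInstanceAs (Fintype α)
  m := S.program E p q

theorem update_input (R L : List α) (O : List Bool) (R' : List α) :
    Function.update (contents R L O) .input R' = contents R' L O := by
  ext1 k; cases k <;> rfl

theorem update_store (R L : List α) (O : List Bool) (L' : List α) :
    Function.update (contents R L O) .store L' = contents R L' O := by
  ext1 k; cases k <;> rfl

theorem update_output (R L : List α) (O : List Bool) (O' : List Bool) :
    Function.update (contents R L O) .output O' = contents R L O' := by
  ext1 k; cases k <;> rfl

theorem rewritePair_eq_some {t x x' t' : α} (h : S.sq t x x' t') :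
    S.rewritePair t x = some (x', t') := by
  have h' : ∃ y : α × α, S.sq t x y.1 y.2 := ⟨(x', t'), h⟩
  rw [rewritePair, dif_pos h']
  exact congrArg some (Prod.ext_iff.2 (S.sq_unique h'.choose_spec h))

theorem rewritePair_eq_none {t x : α} (h : ∀ x' t', ¬ S.sq t x x' t') :
    S.rewritePair t x = none :=
  dif_neg fun ⟨_, h'⟩ => h _ _ h'

section steps

variable [Inhabited α] (p q : V) (v : Registers α V)

theorem step_reduce_nil (L : List α) :
    step (S.program E p q) ⟨some .reduce, v, contents [] L []⟩ =
      some ⟨some .read, (none, none, v.2.2), contents [] L []⟩ := by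
  simp only [step, program, stepAux, update_input]
  rfl

theorem step_reduce_store_nil (x : α) (R : List α) :
    step (S.program E p q) ⟨some .reduce, v, contents (x :: R) [] []⟩ =
      some ⟨some .reduce, (some x, none, v.2.2), contents R [x] []⟩ := by
  simp only [step, program, stepAux, update_input, update_store]
  simp [contents]

theorem step_reduce_cancel (t : α) (R L : List α) :
    step (S.program E p q) ⟨some .reduce, v, contents (S.inv t :: R) (t :: L) []⟩ =
      some ⟨some .reduce, (some (S.inv t), some t, v.2.2), contents R L []⟩ := by
  simp only [step, program, stepAux, update_input, update_store]
  simp [contents]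

theorem step_reduce_swap {t x x' t' : α} (h : S.sq t x x' t') (R L : List α) :
    step (S.program E p q) ⟨some .reduce, v, contents (x :: R) (t :: L) []⟩ =
      some ⟨some .reduce, (some x, some t, v.2.2), contents (x' :: t' :: R) L []⟩ := by
  have hne : x ≠ S.inv t := by
    rintro rfl
    obtain ⟨h₁, h₂, -⟩ := S.vert_of_sq h
    simp [S.vert_inv, h₁] at h₂
  simp only [step, program, stepAux, update_input, update_store]
  simp [contents, hne, S.rewritePair_eq_some h]

theorem step_reduce_push {t x : α} (h : S.IsReducedPair x t) (R L : List α) :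
    step (S.program E p q) ⟨some .reduce, v, contents (x :: R) (t :: L) []⟩ =
      some ⟨some .reduce, (some x, some t, v.2.2), contents R (x :: t :: L) []⟩ := by
  simp only [step, program, stepAux, update_input, update_store]
  simp [contents, h.1, S.rewritePair_eq_none h.2]

theorem step_read_cons (a : α) (L : List α) :
    step (S.program E p q) ⟨some .read, v, contents [] (a :: L) []⟩ =
      some ⟨some .read, (some a, none, predecessors E a v.2.2), contents [] L []⟩ := by
  simp only [step, program, stepAux, update_store]
  simp [contents]

open Classical in
theorem step_read_nil :
    step (S.program E p q) ⟨some .read, v, contents [] [] []⟩ =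
      some ⟨none, (none, none, {q}), contents [] [] [decide (p ∈ v.2.2)]⟩ := by
  simp only [step, program, stepAux, update_store]
  simp [contents, update_output]
  rfl

end steps

open StateTransition

theorem evalsToInTime_of_step {σ : Type*} {f : σ → Option σ} {a b : σ} {c : Option σ} {m : ℕ}
    (h : f a = some b) (h' : Nonempty (EvalsToInTime f b c m)) :
    Nonempty (EvalsToInTime f a c (m + 1)) := by
  obtain ⟨h'⟩ := h'
  exact ⟨.trans f 1 m a b c ⟨⟨1, by simpa [flip] using h⟩, le_rfl⟩ h'⟩

theorem evalsToInTime_of_le {σ : Type*} {f : σ → Option σ} {a : σ} {c : Option σ} {m m' : ℕ}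
    (h : Nonempty (EvalsToInTime f a c m)) (hm : m ≤ m') :
    Nonempty (EvalsToInTime f a c m') := by
  obtain ⟨h⟩ := h
  exact ⟨⟨h.toEvalsTo, h.steps_le_m.trans hm⟩⟩

/-- The reduction phase. The length of the input, plus twice the number of inversions of the whole
word, decreases in each step: a swap makes the input longer by one letter, but it removes an
inversion. -/
theorem exists_evalsToInTime_reduce [Inhabited α] (p q : V) (N : ℕ) :
    ∀ (R L : List α) (v : Registers α V), L.IsChain S.IsReducedPair →
      R.length + 2 * S.inversions (L.reverse ++ R) ≤ N →
      ∃ L', L'.IsChain S.IsReducedPair ∧ S.Steps (L.reverse ++ R) L'.reverse ∧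
        Nonempty (EvalsToInTime (step (S.program E p q)) ⟨some .reduce, v, contents R L []⟩
          (some ⟨some .read, (none, none, v.2.2), contents [] L' []⟩) (N + 1)) := by
  induction N with
  | zero =>
    intro R L v hL hN
    obtain rfl : R = [] := List.length_eq_zero_iff.1 (by omega)
    exact ⟨L, hL, by rw [List.append_nil], evalsToInTime_of_step (S.step_reduce_nil E p q v L)
      ⟨.refl _ _⟩⟩
  | succ N ih =>
    intro R L v hL hN
    rcases R with _ | ⟨x, R⟩
    · exact ⟨L, hL, by rw [List.append_nil], evalsToInTime_of_le (m := 1)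
        (evalsToInTime_of_step (S.step_reduce_nil E p q v L) ⟨.refl _ _⟩) (by omega)⟩
    rw [List.length_cons] at hN
    rcases L with _ | ⟨t, L⟩
    · obtain ⟨L', h₁, h₂, h₃⟩ := ih R [x] (some x, none, v.2.2) (by simp) (by simp at hN ⊢; omega)
      exact ⟨L', h₁, h₂, evalsToInTime_of_step (S.step_reduce_store_nil E p q v x R) h₃⟩
    rw [List.reverse_cons, List.append_assoc, List.singleton_append] at hN ⊢
    by_cases hx : x = S.inv t
    · subst hx
      have hs : S.Step (L.reverse ++ t :: S.inv t :: R) (L.reverse ++ R) :=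
        (Step.cancel t R).append_left _
      have := hs.inversions_le
      obtain ⟨L', h₁, h₂, h₃⟩ := ih R L (some (S.inv t), some t, v.2.2) hL.tail (by omega)
      exact ⟨L', h₁, .head hs h₂, evalsToInTime_of_step (S.step_reduce_cancel E p q v t R L) h₃⟩
    by_cases hsq : ∃ x' t', S.sq t x x' t'
    · obtain ⟨x', t', h⟩ := hsq
      have hi := inversions_append_swap h L.reverse R
      obtain ⟨L', h₁, h₂, h₃⟩ := ih (x' :: t' :: R) L (some x, some t, v.2.2) hL.tail
        (by simp only [List.length_cons]; omega)
      exact ⟨L', h₁, .head ((Step.swap h R).append_left _) h₂,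
        evalsToInTime_of_step (S.step_reduce_swap E p q v h R L) h₃⟩
    · have h : S.IsReducedPair x t := ⟨hx, fun x' t' h => hsq ⟨x', t', h⟩⟩
      have hw : (x :: t :: L).reverse ++ R = L.reverse ++ t :: x :: R := by simp
      obtain ⟨L', h₁, h₂, h₃⟩ := ih R (x :: t :: L) (some x, some t, v.2.2)
        (List.isChain_cons_cons.2 ⟨h, hL⟩) (by rw [hw]; omega)
      rw [hw] at h₂
      exact ⟨L', h₁, h₂, evalsToInTime_of_step (S.step_reduce_push E p q v h R L) h₃⟩

open Classical in
/-- The reading phase. The register holds the set of the vertices from which the letters that have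
been read lead to `q`. -/
theorem evalsToInTime_read [Inhabited α] (p q : V) (L : List α) (v : Registers α V) :
    Nonempty (EvalsToInTime (step (S.program E p q)) ⟨some .read, v, contents [] L []⟩
      (some ⟨none, (none, none, {q}),
        contents [] [] [decide (∃ j ∈ v.2.2, LabelsPath E p L.reverse j)]⟩) (L.length + 1)) := by
  induction L generalizing v with
  | nil =>
    have h : (∃ j ∈ v.2.2, LabelsPath E p [].reverse j) ↔ p ∈ v.2.2 := by
      constructor
      · rintro ⟨j, hj, h⟩
        cases h
        exact hj
      · exact fun h => ⟨p, h, .nil p⟩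
    simp only [h]
    exact evalsToInTime_of_step (S.step_read_nil E p q v) ⟨.refl _ _⟩
  | cons a L ih =>
    have h : (∃ j ∈ v.2.2, LabelsPath E p (a :: L).reverse j) ↔
        ∃ i ∈ predecessors E a v.2.2, LabelsPath E p L.reverse i := by
      simp only [List.reverse_cons, labelsPath_append_iff]
      constructor
      · rintro ⟨j, hj, i, hi, h⟩
        cases h with
        | cons h hw =>
          cases hw
          exact ⟨i, ⟨j, hj, h⟩, hi⟩
      · rintro ⟨i, ⟨j, hj, h⟩, hi⟩
        exact ⟨j, hj, i, hi, .cons h (.nil j)⟩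
    simp only [h]
    exact evalsToInTime_of_step (S.step_read_cons E p q v a L) (ih (some a, none, _))

/-- It is decidable in polynomial time whether the irreducible descendant of a word labels a path
in a finite graph. -/
theorem nonempty_tm2ComputableInPolyTime [Finite α] [Inhabited α] [Finite V] (p q : V)
    (f : List α → Bool)
    (hf : ∀ w z, S.Steps w z → (∀ z', ¬ S.Step z z') → (f w = true ↔ LabelsPath E p z q)) :
    Nonempty (Turing.TM2ComputableInPolyTime (id : List α → List α)
      Computability.encodeBool f) := by
  classical
  have := Fintype.ofFinite α
  have key : ∀ w : List α, Nonempty (Turing.TM2OutputsInTime (S.machine E p q) w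
      (some (Computability.encodeBool (f w)))
      ((2 * Polynomial.X ^ 2 + 2 * Polynomial.X + 2 : Polynomial ℕ).eval w.length)) := by
    intro w
    obtain ⟨L, h₁, h₂, ⟨h₃⟩⟩ := S.exists_evalsToInTime_reduce E p q _ w [] (none, none, {q})
      .nil le_rfl
    obtain ⟨h₄⟩ := S.evalsToInTime_read E p q L (none, none, {q})
    have h₅ : decide (∃ j ∈ ({q} : Set V), LabelsPath E p L.reverse j) = f w := by
      rw [Bool.eq_iff_iff, decide_eq_true_iff, hf w _ h₂ fun z' => not_step_of_isChain
        (List.isChain_reverse.2 h₁)]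
      simp
    have h₆ := Steps.length_le h₂
    have h₇ := S.inversions_le w
    simp only [List.reverse_nil, List.nil_append, List.length_reverse] at h₆
    simp only [h₅] at h₄
    have h₈ := EvalsToInTime.trans _ _ _ _ _ _ h₃ h₄
    have hi : Turing.initList (S.machine E p q) w =
        ⟨some .reduce, (none, none, {q}), contents w [] []⟩ := by
      refine congrArg (Turing.TM2.Cfg.mk _ _) ?_
      ext1 k
      cases k <;> rfl
    have ho : Turing.haltList (S.machine E p q) [f w] =
        ⟨none, (none, none, {q}), contents [] [] [f w]⟩ := by
      refine congrArg (Turing.TM2.Cfg.mk _ _) ?_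
      ext1 k
      cases k <;> rfl
    change Nonempty (EvalsToInTime _ (Turing.initList (S.machine E p q) w)
      (some (Turing.haltList (S.machine E p q) [f w])) _)
    rw [hi, ho]
    refine evalsToInTime_of_le ⟨h₈⟩ ?_
    simp only [Polynomial.eval_add, Polynomial.eval_mul, Polynomial.eval_pow, Polynomial.eval_X,
      Polynomial.eval_ofNat, List.reverse_nil, List.nil_append]
    omega
  refine ⟨{
    tm := S.machine E p q
    inputAlphabet := Equiv.refl α
    outputAlphabet := Equiv.refl Bool
    time := 2 * Polynomial.X ^ 2 + 2 * Polynomial.X + 2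
    outputsFun := fun w => ?_ }⟩
  have h := (key w).some
  have h₁ : List.map (Equiv.refl α).invFun (id w) = w := List.map_id w
  have h₂ : List.map (Equiv.refl Bool).invFun (Computability.encodeBool (f w)) =
    Computability.encodeBool (f w) := List.map_id _
  exact h₁.symm ▸ h₂.symm ▸ h

end SwapSystem

theorem theorem2p9 (n : ℕ) (D : KnotDiagram n) (hprime : D.Prime) (hred : D.Reduced)
    (halt : D.Alternating) :
    (∀ w : D.Word, D.IsGeodesicWord w → ∀ a b : ℤ,
      (D.eval w = D.longitude ^ a * D.meridian ^ b ↔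
        D.LabelsGeodesicPath .left w (0, 0) (a * n - b, a * n + b)) ∧
      (D.eval w = D.longitude ^ a * D.meridian ^ b ↔
        D.LabelsGeodesicPath .right w (0, 0) (a * n + b, a * n - b))) ∧
    Nonempty (Turing.TM2ComputableInPolyTime (id : D.Word → List (D.Region × Bool))
      Computability.encodeBool D.peripheralWordProblem) := by
  constructor
  · intro w hw a b
    have key := hw.eval_eq_iff hprime hred halt a b
    constructor
    · rw [key, hw.labelsGeodesicPath_iff (g := D.longitude ^ a * D.meridian ^ b),
        KnotDiagram.labelsPath_left_iff]
      exact fun w' h => KnotDiagram.eval_eq_of_labelsPath hprime hred halt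
        (KnotDiagram.labelsPath_left_iff.1 h)
    · rw [key, hw.labelsGeodesicPath_iff (g := D.longitude ^ a * D.meridian ^ b),
        KnotDiagram.labelsPath_right_iff]
      · rfl
      · exact fun w' h => KnotDiagram.eval_eq_of_labelsPath hprime hred halt
          (KnotDiagram.labelsPath_right_iff.1 h)
  · classical
    have := D.neZero_two_mul
    have : Inhabited (D.Region × Bool) := ⟨(D.regionAt 0 .left, true)⟩
    refine (KnotDiagram.swapSystem hprime hred halt).nonempty_tm2ComputableInPolyTime D.TorusEdge
      D.firstUnder D.firstUnder _ fun w z h hz => ?_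
    rw [KnotDiagram.peripheralWordProblem, decide_eq_true_iff, KnotDiagram.eval_eq_of_steps h,
      KnotDiagram.isPeripheral_iff_of_irreducible hprime hred halt hz]
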